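/- Let $\Phi:\{1,\dots,B\}\to\{1,\dots,A\}$, let $D\subseteq\mathbb{R}^m$ be a parameter domain on which derivatives are uniquely determined at each point (a set of unique differentiability, e.g. an open set, or a convex set with non-empty interior), and let $\hat\varepsilon\in D$; boundary points of $D$ are allowed. For each $\varepsilon\in D$ let $Y^{\varepsilon}=(Y^{\varepsilon}_k)_{k\in\mathbb{Z}}$ be a stationary Markov chain on $\{1,\dots,B\}$ with probability transition matrix $\Delta(\varepsilon)$, and let $Z^{\varepsilon}=\Phi(Y^{\varepsilon})$ be the corresponding hidden Markov chain. Suppose that the entries of $\Delta$ are real analytic functions of $\varepsilon$ at $\hat\varepsilon$ (on $D$ near $\hat\varepsilon$ they are given by convergent power series in $\varepsilon-\hat\varepsilon$). For $1\le a\le A$ let $\Delta_a$ be the $B\times B$ matrix with $\Delta_a(i,j)=\Delta(i,j)$ if $\Phi(j)=a$ and $\Delta_a(i,j)=0$ otherwise. Put $H_n(Z)=H(Z_0\mid Z_{-n}^{-1})$ (conditional Shannon entropy with natural logarithm) and $H(Z)=\lim_{n\to\infty}H_n(Z)$, the entropy rate; both are functions of $\varepsilon\in D$. Suppose that at $\varepsilon=\hat\varepsilon$,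 for every $a$, the matrix $\Delta_a$ has rank one and every column of $\Delta_a$ is either strictly positive or zero. Then for all integers $\alpha_1,\dots,\alpha_m\ge 0$, with $N=\alpha_1+\cdots+\alpha_m$, the functions $H(Z)$ and $H_{\lceil (N+1)/2\rceil}(Z)$ are $N$ times continuously differentiable at $\hat\varepsilon$ relative to $D$ (i.e. on a neighbourhood of $\hat\varepsilon$ in $D$), and $$\left.\frac{\partial^{N}H(Z)}{\partial\varepsilon_1^{\alpha_1}\cdots\partial\varepsilon_m^{\alpha_m}}\right|_{\varepsilon=\hat\varepsilon}=\left.\frac{\partial^{N}H_{\lceil (N+1)/2\rceil}(Z)}{\partial\varepsilon_1^{\alpha_1}\cdots\partial\varepsilon_m^{\alpha_m}}\right|_{\varepsilon=\hat\varepsilon},$$ where the derivatives are taken relative to $D$ (one-sided if $\hat\varepsilon$ is on the boundary of $D$). -/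

import Mathlib

open MeasureTheory Filter Topology

noncomputable section

namespace HiddenMarkov

/-- The matrix `Δ_a`: the columns `j` of `Δ` with `Φ j = a` are kept, the others are replaced
by zero. -/
def symbolMatrix {A B : ℕ} (Φ : Fin B → Fin A) (Δ : Matrix (Fin B) (Fin B) ℝ) (a : Fin A) :
    Matrix (Fin B) (Fin B) ℝ :=
  Matrix.of fun i j => if Φ j = a then Δ i j else 0

/-- The Black Hole condition: every `Δ_a` has rank one, and each of its columns is either
strictly positive or zero. -/
def IsBlackHole {A B : ℕ} (Φ : Fin B → Fin A) (Δ : Matrix (Fin B) (Fin B) ℝ) : Prop :=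
  ∀ a, (symbolMatrix Φ Δ a).rank = 1 ∧
    ∀ j, (∀ i, 0 < symbolMatrix Φ Δ a i j) ∨ (∀ i, symbolMatrix Φ Δ a i j = 0)

/-- `Y = (Y_k)_{k ∈ ℤ}` is, under the probability measure `μ`, a stationary Markov chain with
transition matrix `Δ`. The Markov property is written without division:
`P(Y_k^{k+n+1} = y_0^{n+1}) = P(Y_k^{k+n} = y_0^n) Δ(y_n, y_{n+1})`. -/
structure IsStationaryMarkovChain {Ω : Type*} [MeasurableSpace Ω] (μ : Measure Ω) {B : ℕ}
    (Δ : Matrix (Fin B) (Fin B) ℝ) (Y : ℤ → Ω → Fin B) : Prop where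
  isProbabilityMeasure : IsProbabilityMeasure μ
  measurable : ∀ k, Measurable (Y k)
  isTransitionMatrix : Δ ∈ Matrix.rowStochastic ℝ (Fin B)
  stationary : ∀ (k : ℤ) (n : ℕ) (y : Fin n → Fin B),
    μ.real {ω | ∀ i : Fin n, Y (k + (i : ℕ)) ω = y i} =
      μ.real {ω | ∀ i : Fin n, Y ((i : ℕ) : ℤ) ω = y i}
  markov : ∀ (k : ℤ) (n : ℕ) (y : Fin (n + 2) → Fin B),
    μ.real {ω | ∀ i : Fin (n + 2), Y (k + (i : ℕ)) ω = y i} =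
      μ.real {ω | ∀ i : Fin (n + 1), Y (k + (i : ℕ)) ω = y i.castSucc} *
        Δ (y (Fin.last n).castSucc) (y (Fin.last (n + 1)))

/-- The conditional Shannon entropy `H(X | W)` of finitely-valued random variables, in nats:
`-∑ p(w, x) log p(x | w)`. Terms with `p(w, x) = 0` vanish. -/
def condEntropy {Ω : Type*} [MeasurableSpace Ω] (μ : Measure Ω) {S T : Type*} [Fintype S]
    [Fintype T] (X : Ω → S) (W : Ω → T) : ℝ :=
  -∑ w : T, ∑ x : S, μ.real {ω | W ω = w ∧ X ω = x} *
    Real.log (μ.real {ω | W ω = w ∧ X ω = x} / μ.real {ω | W ω = w})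

/-- `H_n(Z) = H(Z_0 | Z_{-n}^{-1})`; the conditioning block is `(Z_{-1}, …, Z_{-n})`. -/
def blockEntropy {Ω : Type*} [MeasurableSpace Ω] (μ : Measure Ω) {A : ℕ} (Z : ℤ → Ω → Fin A)
    (n : ℕ) : ℝ :=
  condEntropy μ (Z 0) (fun ω (i : Fin n) => Z (-((i : ℕ) + 1)) ω)

/-- The entropy rate `H(Z) = lim_n H_n(Z)`. The limit exists for every process, see
`tendsto_blockEntropy`. -/
def entropyRate {Ω : Type*} [MeasurableSpace Ω] (μ : Measure Ω) {A : ℕ} (Z : ℤ → Ω → Fin A) : ℝ :=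
  limUnder atTop (fun n : ℕ => blockEntropy μ Z n)

/-- Partitioning an event according to the value of a finitely-valued random variable. -/
theorem measureReal_fiber_sum {Ω : Type*} [MeasurableSpace Ω] (μ : Measure Ω)
    [IsFiniteMeasure μ] {T : Type*} [Fintype T] [DecidableEq T]
    (V : Ω → T) (hV : ∀ t, MeasurableSet {ω | V ω = t}) (s : Finset T)
    (E : Set Ω) :
    μ.real {ω | V ω ∈ s ∧ ω ∈ E} = ∑ t ∈ s, μ.real {ω | V ω = t ∧ ω ∈ E} := by
  induction s using Finset.induction_on with
  | empty => simp
  | insert a s ha ih =>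
    rw [Finset.sum_insert ha, ← ih,
      ← measureReal_inter_add_sdiff (s := {ω | V ω ∈ insert a s ∧ ω ∈ E}) (hV a)]
    congr 2
    · ext ω
      simp only [Set.mem_inter_iff, Set.mem_ofPred_eq, Finset.mem_insert]
      tauto
    · ext ω
      simp only [Set.mem_sdiff, Set.mem_ofPred_eq, Finset.mem_insert]
      constructor
      · tauto
      · rintro ⟨h1, h2⟩
        exact ⟨⟨Or.inr h1, h2⟩, fun h => ha (h ▸ h1)⟩

/-- Conditioning on more does not increase entropy. -/
theorem condEntropy_le {Ω : Type*} [MeasurableSpace Ω] (μ : Measure Ω) [IsFiniteMeasure μ]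
    {S T T' : Type*} [Fintype S] [Fintype T] [Fintype T']
    (X : Ω → S)
    (V : Ω → T') (hV : ∀ t, MeasurableSet {ω | V ω = t}) (g : T' → T) :
    condEntropy μ X V ≤ condEntropy μ X (fun ω => g (V ω)) := by
  classical
  unfold condEntropy
  rw [neg_le_neg_iff]
  set p : T → S → ℝ := fun w x => μ.real {ω | g (V ω) = w ∧ X ω = x} with hp
  set q : T → ℝ := fun w => μ.real {ω | g (V ω) = w} with hq
  have hpsum : ∀ w x, p w x = ∑ v with g v = w, μ.real {ω | V ω = v ∧ X ω = x} := by
    intro w x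
    have := measureReal_fiber_sum μ V hV (Finset.univ.filter fun v => g v = w) {ω | X ω = x}
    simpa [hp] using this
  have hqsum : ∀ w, q w = ∑ v with g v = w, μ.real {ω | V ω = v} := by
    intro w
    have := measureReal_fiber_sum μ V hV (Finset.univ.filter fun v => g v = w) Set.univ
    simpa [hq] using this
  rw [← Finset.sum_fiberwise_of_maps_to (s := Finset.univ) (t := Finset.univ) (g := g)
    (fun _ _ => Finset.mem_univ _)]
  refine Finset.sum_le_sum fun w _ => ?_
  rw [Finset.sum_comm]
  refine Finset.sum_le_sum fun x _ => ?_
  change p w x * Real.log (p w x / q w) ≤ _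
  have hp0 : 0 ≤ p w x := measureReal_nonneg
  have hle : p w x ≤ q w := measureReal_mono (fun ω h => h.1)
  rcases hp0.eq_or_lt with h0 | hpos
  · have : ∀ v ∈ Finset.univ.filter (fun v => g v = w), μ.real {ω | V ω = v ∧ X ω = x} = 0 := by
      have h := hpsum w x
      rw [← h0] at h
      exact (Finset.sum_eq_zero_iff_of_nonneg (fun _ _ => measureReal_nonneg)).1 h.symm
    rw [← h0, zero_mul]
    refine le_of_eq (Finset.sum_eq_zero fun v hv => ?_).symm
    rw [this v hv, zero_mul]
  · have hqpos : 0 < q w := hpos.trans_le hle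
    set c := p w x / q w with hc
    have hcpos : 0 < c := div_pos hpos hqpos
    have key : ∀ v, μ.real {ω | V ω = v ∧ X ω = x} * Real.log c +
        μ.real {ω | V ω = v ∧ X ω = x} - μ.real {ω | V ω = v} * c ≤
        μ.real {ω | V ω = v ∧ X ω = x} *
          Real.log (μ.real {ω | V ω = v ∧ X ω = x} / μ.real {ω | V ω = v}) := by
      intro v
      have ha0 : 0 ≤ μ.real {ω | V ω = v ∧ X ω = x} := measureReal_nonneg
      have hab : μ.real {ω | V ω = v ∧ X ω = x} ≤ μ.real {ω | V ω = v} :=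
        measureReal_mono (fun ω h => h.1)
      generalize μ.real {ω | V ω = v ∧ X ω = x} = a at *
      generalize μ.real {ω | V ω = v} = b at *
      rcases ha0.eq_or_lt with h | h
      · subst h
        have := mul_nonneg hab hcpos.le
        simpa using this
      · have hb : 0 < b := h.trans_le hab
        have h1 := Real.log_le_sub_one_of_pos (x := c / (a / b)) (by positivity)
        rw [Real.log_div hcpos.ne' (by positivity)] at h1
        have h2 : a * (c / (a / b) - 1) = b * c - a := by field_simp
        nlinarith [mul_le_mul_of_nonneg_left h1 h.le]
    calc p w x * Real.log c = p w x * Real.log c + p w x - q w * c := by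
          rw [hc]; field_simp; ring
      _ = ∑ v with g v = w, (μ.real {ω | V ω = v ∧ X ω = x} * Real.log c +
            μ.real {ω | V ω = v ∧ X ω = x} - μ.real {ω | V ω = v} * c) := by
          rw [Finset.sum_sub_distrib, Finset.sum_add_distrib, ← Finset.sum_mul,
            ← Finset.sum_mul, ← hpsum, ← hqsum]
      _ ≤ _ := Finset.sum_le_sum fun v _ => key v

theorem condEntropy_nonneg {Ω : Type*} [MeasurableSpace Ω] (μ : Measure Ω) [IsFiniteMeasure μ]
    {S T : Type*} [Fintype S] [Fintype T] (X : Ω → S) (W : Ω → T) : 0 ≤ condEntropy μ X W := by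
  unfold condEntropy
  rw [neg_nonneg]
  refine Finset.sum_nonpos fun w _ => Finset.sum_nonpos fun x _ => ?_
  refine mul_nonpos_of_nonneg_of_nonpos measureReal_nonneg (Real.log_nonpos
    (div_nonneg measureReal_nonneg measureReal_nonneg) (div_le_one_of_le₀ ?_ measureReal_nonneg))
  exact measureReal_mono (fun ω h => h.1)

/-- The limit that defines the entropy rate exists. -/
theorem tendsto_blockEntropy {Ω : Type*} [MeasurableSpace Ω] (μ : Measure Ω) [IsFiniteMeasure μ]
    {A : ℕ} (Z : ℤ → Ω → Fin A) (hZ : ∀ k, Measurable (Z k)) :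
    Tendsto (fun n : ℕ => blockEntropy μ Z n) atTop (𝓝 (entropyRate μ Z)) := by
  have hanti : Antitone (fun n : ℕ => blockEntropy μ Z n) := by
    refine antitone_nat_of_succ_le fun n => ?_
    refine condEntropy_le μ (Z 0)
      (fun ω (i : Fin (n + 1)) => Z (-((i : ℕ) + 1)) ω) (fun t => ?_)
      (fun v (i : Fin n) => v i.castSucc)
    exact measurable_pi_lambda _ (fun i => hZ _) (measurableSet_singleton t)
  have hbdd : BddBelow (Set.range fun n : ℕ => blockEntropy μ Z n) :=
    ⟨0, by rintro _ ⟨n, rfl⟩; exact condEntropy_nonneg μ _ _⟩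
  exact tendsto_nhds_limUnder ⟨_, tendsto_atTop_ciInf hanti hbdd⟩

/-- The mixed partial derivative `∂^N f / ∂ε_{i 0} ⋯ ∂ε_{i (N-1)}` at `x`, relative to the domain
`D` of `f`. The multi-index `α` corresponds to any `i` that takes each value `l` exactly `α_l`
times. -/
def mixedPartialWithin {m N : ℕ} (i : Fin N → Fin m) (f : (Fin m → ℝ) → ℝ) (D : Set (Fin m → ℝ))
    (x : Fin m → ℝ) : ℝ :=
  iteratedFDerivWithin ℝ N f D x (fun k => Pi.single (i k) 1)

end HiddenMarkov

end

/-! At `ε₀` every `Δ_a` is a rank-one matrix `u_a ⊗ v_a`, so observing the letter `a` resets the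
conditional law of the hidden state to `v_a`: the past is forgotten at once. If the matrices are
moved by `θ`, one step of the filter depends on its input only through a term of size `θ`, hence
contracts with a factor O(`θ`) (`IsNear.norm_filterStep_sub_le`). The predictive laws of the next
letter given `n` and given `n + 1` letters therefore differ by O(`θ ^ n`). The increment `H_{n+1} -
H_n` is a weighted sum of relative entropies between these laws; relative entropy is quadratic in
the difference, which doubles the exponent to `2 * n` (`IsNear.norm_wordEntropy_succ_sub_le`).

A bound on real values alone says nothing about derivatives, so all of this is done over ℂ. The
transition matrix and the stationary law extend holomorphically to a neighbourhood of `ε₀` in ℂ^m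
(`exists_stochastic_extension`, `exists_holomorphic_wordEntropy`), where `θ` is comparable to the
distance `‖z - z₀‖`. The increments sum to a holomorphic limit that differs from `H_n` by O(`‖z -
z₀‖ ^ (2 * n)`) (`exists_limit_of_norm_succ_sub_le`), and Cauchy's estimate makes all derivatives of
order `N < 2 * n` agree. Because the extensions live on a full neighbourhood, boundary points of `D`
need no separate treatment. -/

noncomputable section

namespace HiddenMarkov

/-! ### Cauchy estimates, series of holomorphic functions, holomorphic extension. -/

section Smooth

open scoped ContDiff

/-- Cauchy's estimate for the Fréchet derivative of a function on a complex normed space. -/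
theorem norm_fderiv_le_of_closedBall {E F : Type*} [NormedAddCommGroup E] [NormedSpace ℂ E]
    [NormedAddCommGroup F] [NormedSpace ℂ F] {f : E → F} {U : Set E} (hU : IsOpen U)
    (hf : DifferentiableOn ℂ f U) {y : E} {δ M : ℝ} (hδ : 0 < δ)
    (hsub : Metric.closedBall y δ ⊆ U) (hM : ∀ z ∈ Metric.closedBall y δ, ‖f z‖ ≤ M) :
    ‖fderiv ℂ f y‖ ≤ M / δ := by
  have hy : y ∈ Metric.closedBall y δ := Metric.mem_closedBall_self hδ.le
  have hM0 : 0 ≤ M := (norm_nonneg _).trans (hM y hy)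
  refine ContinuousLinearMap.opNorm_le_bound _ (by positivity) fun v => ?_
  rcases eq_or_ne v 0 with rfl | hv
  · simp
  have hv' : 0 < ‖v‖ := norm_pos_iff.2 hv
  have hmem : ∀ t ∈ Metric.closedBall (0 : ℂ) (δ / ‖v‖), y + t • v ∈ Metric.closedBall y δ := by
    intro t ht
    rw [mem_closedBall_zero_iff, le_div_iff₀ hv'] at ht
    simpa [norm_smul] using ht
  have hd : ∀ t ∈ Metric.closedBall (0 : ℂ) (δ / ‖v‖),
      HasDerivAt (fun t : ℂ => f (y + t • v)) (fderiv ℂ f (y + t • v) v) t := by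
    intro t ht
    have h1 : HasFDerivAt f (fderiv ℂ f (y + t • v)) (y + t • v) :=
      (hf.differentiableAt (hU.mem_nhds (hsub (hmem t ht)))).hasFDerivAt
    have h2 : HasDerivAt (fun t : ℂ => y + t • v) v t := by
      simpa using ((hasDerivAt_id t).smul_const v).const_add y
    exact h1.comp_hasDerivAt t h2
  have h0 := hd 0 (Metric.mem_closedBall_self (by positivity))
  -- The one-variable Cauchy estimate on the complex line through `y` in direction `v`; the radius
  -- `δ / ‖v‖` is the largest for which the disc stays in the closed ball.
  have key := Complex.norm_deriv_le_of_forall_mem_sphere_norm_le (c := 0) (R := δ / ‖v‖) (C := M)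
    (f := fun t : ℂ => f (y + t • v)) (by positivity)
    (DifferentiableOn.diffContOnCl (fun t ht => by
      refine (hd t ?_).differentiableAt.differentiableWithinAt
      exact Metric.closure_ball_subset_closedBall ht))
    (fun t ht => hM _ (hmem t (Metric.sphere_subset_closedBall ht)))
  rw [h0.deriv] at key
  simp only [zero_smul, add_zero] at key
  calc ‖fderiv ℂ f y v‖ ≤ M / (δ / ‖v‖) := key
    _ = M / δ * ‖v‖ := by field_simp

/-- Cauchy's estimate on a slightly smaller ball bounds the derivatives of the terms by a constant
times the same `u`, so the induction differentiates term by term. `F`, `r` and `C` must vary in it: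
derivatives take values in `E →L[ℂ] F`, the ball shrinks and the constant grows. -/
theorem contDiffOn_tsum_ball_nat {E : Type} [NormedAddCommGroup E] [NormedSpace ℂ E] (x : E)
    {u : ℕ → ℝ} (hu : Summable u) (n : ℕ) :
    ∀ {F : Type} [NormedAddCommGroup F] [NormedSpace ℂ F] [CompleteSpace F] {f : ℕ → E → F}
      {r C : ℝ}, (∀ k, ContDiffOn ℂ ∞ (f k) (Metric.ball x r)) →
      (∀ k, ∀ z ∈ Metric.ball x r, ‖f k z‖ ≤ C * u k) →
      ContDiffOn ℂ n (fun z => ∑' k, f k z) (Metric.ball x r) := by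
  induction n with
  | zero =>
    intro F _ _ _ f r C hf hb
    rw [Nat.cast_zero, contDiffOn_zero]
    exact continuousOn_tsum (fun k => (hf k).continuousOn) (hu.mul_left C) hb
  | succ n ih =>
    intro F _ _ _ f r C hf hb y hy
    refine ContDiffAt.contDiffWithinAt ?_
    obtain ⟨r', hyr', hr'⟩ := exists_between (Metric.mem_ball.1 hy)
    have hsub : Metric.ball x r' ⊆ Metric.ball x r := Metric.ball_subset_ball hr'.le
    have hfd : ∀ k, DifferentiableOn ℂ (f k) (Metric.ball x r) := fun k =>
      (hf k).differentiableOn (by simp)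
    have hf' : ∀ k, ContDiffOn ℂ ∞ (fderiv ℂ (f k)) (Metric.ball x r') := fun k =>
      (((contDiffOn_infty_iff_fderiv_of_isOpen Metric.isOpen_ball).1 (hf k)).2).mono hsub
    have hb' : ∀ k, ∀ z ∈ Metric.ball x r', ‖fderiv ℂ (f k) z‖ ≤ C / ((r - r') / 2) * u k := by
      intro k z hz
      have hδ : 0 < (r - r') / 2 := by linarith
      have hs : Metric.closedBall z ((r - r') / 2) ⊆ Metric.ball x r := by
        refine Metric.closedBall_subset_ball' ?_
        have := Metric.mem_ball.1 hz
        linarith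
      have := norm_fderiv_le_of_closedBall Metric.isOpen_ball (hfd k) hδ hs
        (fun w hw => hb k w (hs hw))
      rwa [mul_div_right_comm] at this
    have hder : ∀ z ∈ Metric.ball x r',
        HasFDerivAt (fun z => ∑' k, f k z) (∑' k, fderiv ℂ (f k) z) z := by
      intro z hz
      -- The real structure serves only to call the ball convex, hence preconnected.
      let _ : NormedSpace ℝ E := NormedSpace.restrictScalars ℝ ℂ E
      refine hasFDerivAt_tsum_of_isPreconnected (hu.mul_left (C / ((r - r') / 2)))
        Metric.isOpen_ball (convex_ball x r').isPreconnected
        (fun k w hw => ((hfd k).differentiableAt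
          (Metric.isOpen_ball.mem_nhds (hsub hw))).hasFDerivAt) hb' hz ?_ hz
      exact Summable.of_norm_bounded (hu.mul_left C) (fun k => hb k z (hsub hz))
    have hres : ContDiffOn ℂ ((n : ℕ∞ω) + 1) (fun z => ∑' k, f k z) (Metric.ball x r') := by
      rw [contDiffOn_succ_iff_fderiv_of_isOpen Metric.isOpen_ball]
      refine ⟨fun z hz => (hder z hz).differentiableAt.differentiableWithinAt, by simp, ?_⟩
      exact (ih hf' hb').congr fun z hz => (hder z hz).fderiv
    exact_mod_cast hres.contDiffAt (Metric.isOpen_ball.mem_nhds (Metric.mem_ball.2 hyr'))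

/-- A normally convergent series of smooth functions on a ball of a complex normed space
is smooth. -/
theorem contDiffOn_tsum_ball {E : Type} [NormedAddCommGroup E] [NormedSpace ℂ E] {x : E}
    {F : Type} [NormedAddCommGroup F] [NormedSpace ℂ F] [CompleteSpace F] {f : ℕ → E → F}
    {r : ℝ} {u : ℕ → ℝ} (hu : Summable u) (hf : ∀ k, ContDiffOn ℂ ∞ (f k) (Metric.ball x r))
    (hb : ∀ k, ∀ z ∈ Metric.ball x r, ‖f k z‖ ≤ u k) :
    ContDiffOn ℂ ∞ (fun z => ∑' k, f k z) (Metric.ball x r) :=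
  contDiffOn_infty.2 fun n =>
    contDiffOn_tsum_ball_nat x hu n (C := 1) hf (by simpa using hb)

/-- If a holomorphic function vanishes to order `N + 1` at `ι x`, then the real derivatives of
order `N` of its pullback along a real linear map `ι` vanish at `x`. -/
theorem iteratedFDeriv_comp_eq_zero {E V : Type} [NormedAddCommGroup E] [NormedSpace ℂ E]
    [NormedAddCommGroup V] [NormedSpace ℝ V] (ι : V →L[ℝ] E) (x : V) (N : ℕ) :
    ∀ {F G : Type} [NormedAddCommGroup F] [NormedSpace ℂ F] [NormedAddCommGroup G]
      [NormedSpace ℝ G] (L : F →L[ℝ] G) {g : E → F} {r C : ℝ}, 0 < r →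
      ContDiffOn ℂ ∞ g (Metric.ball (ι x) r) →
      (∀ z ∈ Metric.ball (ι x) r, ‖g z‖ ≤ C * ‖z - ι x‖ ^ (N + 1)) →
      iteratedFDeriv ℝ N (fun y => L (g (ι y))) x = 0 := by
  induction N with
  | zero =>
    intro F G _ _ _ _ L g r C hr hg hb
    have h0 : g (ι x) = 0 := by
      have := hb _ (Metric.mem_ball_self hr)
      simpa using this
    ext v
    simp [h0]
  | succ N ih =>
    intro F G _ _ _ _ L g r C hr hg hb
    have hgd : DifferentiableOn ℂ g (Metric.ball (ι x) r) := hg.differentiableOn (by simp)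
    have hb' : ∀ z ∈ Metric.ball (ι x) (r / 2),
        ‖fderiv ℂ g z‖ ≤ |C| * 2 ^ (N + 2) * ‖z - ι x‖ ^ (N + 1) := by
      intro z hz
      have hzr : ‖z - ι x‖ < r / 2 := by simpa [dist_eq_norm] using hz
      -- Cauchy's estimate on the ball of radius `δ` about `z`, which lies within `2 * δ` of `ι x`.
      -- The choice `δ = ‖z - ι x‖` gives the bound; at `z = ι x`, where it is no radius, `δ` tends
      -- to 0.
      have est : ∀ δ : ℝ, 0 < δ → ‖z - ι x‖ ≤ δ → δ < r / 2 →
          ‖fderiv ℂ g z‖ ≤ |C| * 2 ^ (N + 2) * δ ^ (N + 1) := by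
        intro δ hδ hzδ hδr
        have hin : ∀ w ∈ Metric.closedBall z δ, ‖w - ι x‖ ≤ 2 * δ := by
          intro w hw
          have : ‖w - z‖ ≤ δ := by simpa [dist_eq_norm] using hw
          calc ‖w - ι x‖ = ‖(w - z) + (z - ι x)‖ := by congr 1; abel
            _ ≤ ‖w - z‖ + ‖z - ι x‖ := norm_add_le _ _
            _ ≤ 2 * δ := by linarith
        have hs : Metric.closedBall z δ ⊆ Metric.ball (ι x) r := by
          intro w hw
          rw [Metric.mem_ball, dist_eq_norm]
          linarith [hin w hw]
        have := norm_fderiv_le_of_closedBall Metric.isOpen_ball hgd hδ hs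
          (M := |C| * (2 * δ) ^ (N + 2)) (fun w hw => by
            refine (hb w (hs hw)).trans ?_
            have h1 := hin w hw
            exact mul_le_mul (le_abs_self C) (pow_le_pow_left₀ (norm_nonneg _) h1 _)
              (by positivity) (abs_nonneg C))
        refine this.trans (le_of_eq ?_)
        rw [mul_pow, pow_succ δ (N + 1)]
        field_simp
      rcases (norm_nonneg (z - ι x)).eq_or_lt with h | h
      · have hlim : Tendsto (fun δ : ℝ => |C| * 2 ^ (N + 2) * δ ^ (N + 1)) (𝓝[>] 0)
            (𝓝 (|C| * 2 ^ (N + 2) * 0 ^ (N + 1))) := by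
          refine Tendsto.mono_left ?_ nhdsWithin_le_nhds
          exact (Continuous.tendsto (by fun_prop) 0)
        rw [← h]
        refine ge_of_tendsto hlim ?_
        filter_upwards [Ioo_mem_nhdsGT (show (0 : ℝ) < r / 2 by positivity)] with δ hδ
        exact est δ hδ.1 (by rw [← h]; exact hδ.1.le) hδ.2
      · exact est _ h le_rfl hzr
    -- The real derivative of `L ∘ g ∘ ι` is again of this form, with `fderiv ℂ g` for `g` and `L'`
    -- for `L`; hence the general `L` in the statement.
    let L' : (E →L[ℂ] F) →L[ℝ] (V →L[ℝ] G) :=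
      ((ContinuousLinearMap.compL ℝ V E G).flip ι).comp
        ((ContinuousLinearMap.compL ℝ E F G L).comp
          (ContinuousLinearMap.restrictScalarsL ℂ E F ℝ ℝ))
    have hder : ∀ᶠ y in 𝓝 x, fderiv ℝ (fun y => L (g (ι y))) y = L' (fderiv ℂ g (ι y)) := by
      filter_upwards [ι.continuous.continuousAt.preimage_mem_nhds
        (Metric.isOpen_ball.mem_nhds (Metric.mem_ball_self hr))] with y hy
      have h1 : HasFDerivAt g (fderiv ℂ g (ι y)) (ι y) :=
        (hgd.differentiableAt (Metric.isOpen_ball.mem_nhds hy)).hasFDerivAt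
      exact (L.hasFDerivAt.comp y ((h1.restrictScalars ℝ).comp y ι.hasFDerivAt)).fderiv
    have hg' : ContDiffOn ℂ ∞ (fderiv ℂ g) (Metric.ball (ι x) (r / 2)) :=
      ((contDiffOn_infty_iff_fderiv_of_isOpen Metric.isOpen_ball).1 hg).2.mono
        (Metric.ball_subset_ball (by linarith))
    rw [iteratedFDeriv_succ_eq_comp_right, Function.comp_apply,
      (Filter.EventuallyEq.iteratedFDeriv ℝ hder N).eq_of_nhds,
      ih L' (by positivity) hg' hb']
    exact LinearIsometryEquiv.map_zero _

/-- The coordinatewise inclusion `ℝ^m → ℂ^m`. -/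
def realToComplex (m : ℕ) : (Fin m → ℝ) →L[ℝ] (Fin m → ℂ) :=
  ContinuousLinearMap.pi fun i => Complex.ofRealCLM.comp (ContinuousLinearMap.proj i)

@[simp]
theorem realToComplex_apply {m : ℕ} (x : Fin m → ℝ) (i : Fin m) :
    realToComplex m x i = (x i : ℂ) := rfl

/-- A real analytic function on a subset of `ℝ^m` extends to a holomorphic function on a
neighbourhood in `ℂ^m`. -/
theorem exists_holomorphic_extension {m : ℕ} {f : (Fin m → ℝ) → ℝ} {D : Set (Fin m → ℝ)}
    {x : Fin m → ℝ} (hf : AnalyticWithinAt ℝ f D x) :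
    ∃ F : (Fin m → ℂ) → ℂ, ∃ r > 0, ContDiffOn ℂ ∞ F (Metric.ball (realToComplex m x) r) ∧
      ∀ y ∈ insert x D, dist y x < r → F (realToComplex m y) = f y := by
  obtain ⟨p, R, hp⟩ := hf
  obtain ⟨C, ρ, hC, hρ, hCρ⟩ := p.le_mul_pow_of_radius_pos (hp.r_pos.trans_le hp.r_le)
  obtain ⟨R', hR', hR'R⟩ := ENNReal.lt_iff_exists_nnreal_btwn.1 hp.r_pos
  -- The first bound keeps real points where the power series converges. The second gives `m * ρ * r
  -- ≤ 1 / 2`, which beats the `m ^ n` monomials of degree `n` with coefficients at most `C * ρ ^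
  -- n`; `m + 1` avoids division by zero.
  let r : ℝ := min (R' : ℝ) (1 / (2 * (m + 1) * ρ))
  have hr : 0 < r := lt_min (by exact_mod_cast hR') (by positivity)
  -- The homogeneous term `p n` expanded in coordinates, so that complex coordinates can be
  -- inserted.
  let g : ℕ → (Fin m → ℂ) → ℂ := fun n z =>
    ∑ i : Fin n → Fin m, ((p n (fun k => Pi.single (i k) 1) : ℝ) : ℂ) *
      ∏ k, (z (i k) - (x (i k) : ℂ))
  have hcoef : ∀ n (i : Fin n → Fin m), ‖p n (fun k => Pi.single (i k) 1)‖ ≤ C * ρ ^ n := by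
    intro n i
    refine ((p n).le_opNorm _).trans ?_
    have : ∏ k : Fin n, ‖(Pi.single (i k) 1 : Fin m → ℝ)‖ = 1 :=
      Finset.prod_eq_one fun k _ => by rw [Pi.norm_single, norm_one]
    rw [this, mul_one]
    exact hCρ n
  have hg : ∀ n, ∀ z ∈ Metric.ball (realToComplex m x) r, ‖g n z‖ ≤ C * (1 / 2) ^ n := by
    intro n z hz
    have hzr : ∀ j, ‖z j - (x j : ℂ)‖ ≤ r := fun j => by
      have h1 : ‖(z - realToComplex m x) j‖ ≤ ‖z - realToComplex m x‖ := norm_le_pi_norm _ _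
      have h2 : ‖z - realToComplex m x‖ < r := by simpa [dist_eq_norm] using hz
      exact h1.trans h2.le
    calc ‖g n z‖ ≤ ∑ i : Fin n → Fin m, C * ρ ^ n * r ^ n := by
          refine norm_sum_le_of_le _ fun i _ => ?_
          rw [norm_mul, Complex.norm_real, norm_prod]
          refine mul_le_mul (hcoef n i) ?_ (by positivity) (by positivity)
          calc ∏ k : Fin n, ‖z (i k) - (x (i k) : ℂ)‖ ≤ ∏ _k : Fin n, r :=
                Finset.prod_le_prod (fun _ _ => norm_nonneg _) fun k _ => hzr _
            _ = r ^ n := by simp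
      _ = C * (m * ρ * r) ^ n := by
          simp only [Finset.sum_const, Finset.card_univ, Fintype.card_fun, Fintype.card_fin,
            nsmul_eq_mul]
          push_cast
          rw [mul_pow, mul_pow]; ring
      _ ≤ C * (1 / 2) ^ n := by
          refine mul_le_mul_of_nonneg_left (pow_le_pow_left₀ (by positivity) ?_ _) hC.le
          have h1 : r ≤ 1 / (2 * (m + 1) * ρ) := min_le_right _ _
          calc m * ρ * r ≤ (m + 1) * ρ * (1 / (2 * (m + 1) * ρ)) := by gcongr; linarith
            _ = 1 / 2 := by field_simp
  refine ⟨fun z => ∑' n, g n z, r, hr, ?_, ?_⟩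
  · refine contDiffOn_tsum_ball (summable_geometric_two.mul_left C) (fun n => ?_) hg
    refine ContDiff.contDiffOn ?_
    refine ContDiff.sum fun i _ => contDiff_const.mul (contDiff_prod fun k _ => ?_)
    exact (contDiff_apply ℂ ℂ (i k)).sub contDiff_const
  · intro y hy hyr
    have hsum := hp.hasSum (y := y - x) (by simpa using hy) (by
      rw [Metric.mem_eball, edist_zero_right, ← ofReal_norm]
      refine lt_of_lt_of_le ?_ hR'R.le
      rw [ENNReal.ofReal_lt_coe_iff (norm_nonneg _), ← dist_eq_norm]
      exact hyr.trans_le (min_le_left _ _))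
    have hterm : ∀ n, g n (realToComplex m y) = ((p n fun _ => y - x : ℝ) : ℂ) := by
      intro n
      have h1 : (y - x) = ∑ j, (y j - x j) • (Pi.single j 1 : Fin m → ℝ) := by
        ext l
        simp [Finset.sum_apply, Pi.single_apply]
      conv_rhs => rw [h1]
      rw [ContinuousMultilinearMap.map_sum]
      simp_rw [ContinuousMultilinearMap.map_smul_univ]
      push_cast
      refine Finset.sum_congr rfl fun i _ => ?_
      simp [mul_comm]
    simp_rw [hterm]
    rw [← Complex.ofReal_tsum, hsum.tsum_eq]
    simp

end Smooth

/-! ### The normalised filter and its contraction. -/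

section Words

variable {α β : Type*} [Fintype β]

/-- The vector of row sums of `T a`. -/
def letterSum (T : α → Matrix β β ℂ) (a : α) : β → ℂ := fun i => ∑ j, T a i j

/-- One step of the normalised filter. -/
def filterStep (T : α → Matrix β β ℂ) (a : α) (x : β → ℂ) : β → ℂ :=
  (x ⬝ᵥ letterSum T a)⁻¹ • Matrix.vecMul x (T a)

/-- The normalised filter along a word, `w 0` being the most recent letter. -/
def wordFilter (T : α → Matrix β β ℂ) : (n : ℕ) → (Fin n → α) → (β → ℂ) → β → ℂ
  | 0, _, x => x
  | n + 1, w, x => filterStep T (w 0) (wordFilter T n (Fin.tail w) x)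

/-- Peeling off the oldest letter instead of the newest presents the filters along `n + 1` and `n`
letters as the same filter with two initial vectors, to which contraction applies. -/
theorem wordFilter_succ_init (T : α → Matrix β β ℂ) (n : ℕ) (w : Fin (n + 1) → α) (x : β → ℂ) :
    wordFilter T (n + 1) w x =
      wordFilter T n (Fin.init w) (filterStep T (w (Fin.last n)) x) := by
  induction n with
  | zero => simp [wordFilter]
  | succ n ih =>
    rw [wordFilter, ih, wordFilter, Fin.tail_init_eq_init_tail]
    rfl

theorem sum_vecMul (T : α → Matrix β β ℂ) (a : α) (x : β → ℂ) :
    ∑ j, Matrix.vecMul x (T a) j = x ⬝ᵥ letterSum T a := by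
  simp only [Matrix.vecMul, dotProduct, letterSum, Finset.mul_sum]
  exact Finset.sum_comm

theorem norm_dotProduct_le (x y : β → ℂ) {X M : ℝ} (hx : ‖x‖ ≤ X) (hy : ∀ i, ‖y i‖ ≤ M) :
    ‖x ⬝ᵥ y‖ ≤ Fintype.card β * (X * M) := by
  have hX : 0 ≤ X := (norm_nonneg _).trans hx
  calc ‖x ⬝ᵥ y‖ ≤ ∑ _i : β, X * M := norm_sum_le_of_le _ fun i _ => by
        rw [norm_mul]
        exact mul_le_mul ((norm_le_pi_norm x i).trans hx) (hy i) (norm_nonneg _) hX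
    _ = Fintype.card β * (X * M) := by simp

/-- Rank-one matrices `u a ⊗ v a` with `2c ≤ u a ≤ 1` and `v a` a probability vector. -/
structure IsRankOneFamily (u v : α → β → ℝ) (c : ℝ) : Prop where
  pos : 0 < c
  le_left : ∀ a i, 2 * c ≤ u a i
  left_le : ∀ a i, u a i ≤ 1
  right_nonneg : ∀ a j, 0 ≤ v a j
  right_sum : ∀ a, ∑ j, v a j = 1

/-- The matrices `T a` are entrywise `θ`-close to `u a ⊗ v a`. -/
def IsNear (T : α → Matrix β β ℂ) (u v : α → β → ℝ) (θ : ℝ) : Prop :=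
  ∀ a i j, ‖T a i j - (u a i : ℂ) * (v a j : ℂ)‖ ≤ θ

/-- Vectors of total mass one that give each letter a weight with real part at least `c`. -/
structure IsGood (T : α → Matrix β β ℂ) (c : ℝ) (x : β → ℂ) : Prop where
  norm_le : ‖x‖ ≤ 2
  sum_eq : ∑ j, x j = 1
  le_re : ∀ a, c ≤ (x ⬝ᵥ letterSum T a).re

/-- A constant that bounds the distortions below. -/
def distortion (β : Type*) [Fintype β] : ℝ := Fintype.card β * (1 + Fintype.card β)

variable {T : α → Matrix β β ℂ} {u v : α → β → ℝ} {c θ : ℝ}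

theorem distortion_nonneg : 0 ≤ distortion β := by unfold distortion; positivity

theorem IsRankOneFamily.right_le (h : IsRankOneFamily u v c) (a : α) (j : β) : v a j ≤ 1 := by
  rw [← h.right_sum a]
  exact Finset.single_le_sum (fun i _ => h.right_nonneg a i) (Finset.mem_univ j)

theorem IsNear.norm_letterSum_sub_le (h : IsRankOneFamily u v c) (hT : IsNear T u v θ) (a : α)
    (i : β) : ‖letterSum T a i - (u a i : ℂ)‖ ≤ Fintype.card β * θ := by
  have h1 : letterSum T a i - (u a i : ℂ) = ∑ j, (T a i j - (u a i : ℂ) * (v a j : ℂ)) := by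
    rw [Finset.sum_sub_distrib, ← Finset.mul_sum, ← Complex.ofReal_sum, h.right_sum]
    simp [letterSum]
  rw [h1]
  refine (norm_sum_le_of_le _ fun j _ => hT a i j).trans ?_
  simp

theorem IsNear.norm_letterSum_le (h : IsRankOneFamily u v c) (hT : IsNear T u v θ) (hθ : θ ≤ 1)
    (a : α) (i : β) : ‖letterSum T a i‖ ≤ 1 + Fintype.card β := by
  have h1 := hT.norm_letterSum_sub_le h a i
  have h2 : ‖(u a i : ℂ)‖ ≤ 1 := by
    rw [Complex.norm_real, Real.norm_of_nonneg (by linarith [h.le_left a i, h.pos])]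
    exact h.left_le a i
  have h3 : (Fintype.card β : ℝ) * θ ≤ Fintype.card β := mul_le_of_le_one_right (by positivity) hθ
  have h4 := norm_add_le (letterSum T a i - (u a i : ℂ)) (u a i : ℂ)
  rw [sub_add_cancel] at h4
  linarith

theorem IsNear.norm_dot_letterSum_le (h : IsRankOneFamily u v c) (hT : IsNear T u v θ)
    (hθ : θ ≤ 1) (a : α) (x : β → ℂ) :
    ‖x ⬝ᵥ letterSum T a‖ ≤ distortion β * ‖x‖ :=
  (norm_dotProduct_le x _ le_rfl (hT.norm_letterSum_le h hθ a)).trans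
    (le_of_eq (by unfold distortion; ring))

/-- The difference between `T a` and the rank-one matrix with the same row sums. -/
def rankOneDefect (T : α → Matrix β β ℂ) (v : α → β → ℝ) (a : α) : Matrix β β ℂ :=
  Matrix.of fun i j => T a i j - letterSum T a i * (v a j : ℂ)

theorem IsNear.norm_vecMul_rankOneDefect_le (h : IsRankOneFamily u v c) (hT : IsNear T u v θ)
    (hθ0 : 0 ≤ θ) (a : α) (x : β → ℂ) :
    ‖Matrix.vecMul x (rankOneDefect T v a)‖ ≤ distortion β * θ * ‖x‖ := by
  rw [pi_norm_le_iff_of_nonneg (by have := distortion_nonneg (β := β); positivity)]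
  intro j
  refine (norm_dotProduct_le x (fun i => rankOneDefect T v a i j) le_rfl
    (M := (1 + Fintype.card β) * θ) fun i => ?_).trans (le_of_eq (by unfold distortion; ring))
  have h1 : rankOneDefect T v a i j = (T a i j - (u a i : ℂ) * (v a j : ℂ)) -
      (letterSum T a i - (u a i : ℂ)) * (v a j : ℂ) := by
    simp only [rankOneDefect, Matrix.of_apply]; ring
  have h2 : ‖(v a j : ℂ)‖ ≤ 1 := by
    rw [Complex.norm_real, Real.norm_of_nonneg (h.right_nonneg a j)]
    exact h.right_le a j
  calc ‖rankOneDefect T v a i j‖ ≤ θ + (Fintype.card β * θ) * 1 := by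
        rw [h1]
        refine (norm_sub_le _ _).trans (add_le_add (hT a i j) ?_)
        rw [norm_mul]
        exact mul_le_mul (hT.norm_letterSum_sub_le h a i) h2 (norm_nonneg _) (by positivity)
    _ = (1 + Fintype.card β) * θ := by ring

/-- The rank-one part maps every `x` to a multiple of `v a`, and normalisation turns this into `v a`
itself. The input survives only through the defect, which has size `θ`. Using the exact row sums of
`T a` in the defect makes this an identity. -/
theorem filterStep_eq (T : α → Matrix β β ℂ) (v : α → β → ℝ) (a : α) {x : β → ℂ}
    (hx : x ⬝ᵥ letterSum T a ≠ 0) :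
    filterStep T a x = (fun j => (v a j : ℂ)) +
      (x ⬝ᵥ letterSum T a)⁻¹ • Matrix.vecMul x (rankOneDefect T v a) := by
  ext j
  have h1 : Matrix.vecMul x (rankOneDefect T v a) j =
      Matrix.vecMul x (T a) j - (x ⬝ᵥ letterSum T a) * (v a j : ℂ) := by
    simp only [Matrix.vecMul, dotProduct, rankOneDefect, Matrix.of_apply, mul_sub,
      Finset.sum_sub_distrib, Finset.sum_mul, mul_assoc]
  simp only [filterStep, Pi.add_apply, Pi.smul_apply, smul_eq_mul, h1]
  field_simp
  ring

theorem IsGood.dot_ne_zero (hc : 0 < c) {x : β → ℂ} (hx : IsGood T c x) (a : α) :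
    x ⬝ᵥ letterSum T a ≠ 0 := by
  intro h0
  have := hx.le_re a
  rw [h0, Complex.zero_re] at this
  linarith

theorem IsGood.le_norm {x : β → ℂ} (hx : IsGood T c x) (a : α) :
    c ≤ ‖x ⬝ᵥ letterSum T a‖ :=
  (hx.le_re a).trans (Complex.re_le_norm _)

/-- Perturbations of probability vectors are good. -/
theorem IsNear.isGood_of_norm_sub_le (h : IsRankOneFamily u v c) (hT : IsNear T u v θ)
    (hθ : θ ≤ 1) {q : β → ℝ} (hq0 : ∀ j, 0 ≤ q j) (hq1 : ∑ j, q j = 1) {x : β → ℂ}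
    (hx1 : ∑ j, x j = 1) {τ : ℝ} (hτ : τ ≤ 1) (hxq : ‖x - (fun j => (q j : ℂ))‖ ≤ τ)
    (hc : distortion β * τ + (Fintype.card β) ^ 2 * θ ≤ c) : IsGood T c x := by
  set q' : β → ℂ := fun j => (q j : ℂ) with hq'
  have hqn : ‖q'‖ ≤ 1 := by
    rw [pi_norm_le_iff_of_nonneg zero_le_one]
    intro j
    rw [hq', Complex.norm_real, Real.norm_of_nonneg (hq0 j), ← hq1]
    exact Finset.single_le_sum (fun i _ => hq0 i) (Finset.mem_univ j)
  refine ⟨?_, hx1, fun a => ?_⟩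
  · have := norm_add_le (x - q') q'
    rw [sub_add_cancel] at this
    linarith
  -- The last summand averages `u a` and is at least `2 * c`; the first two are errors that together
  -- cost at most `c`.
  · have h1 : x ⬝ᵥ letterSum T a = (x - q') ⬝ᵥ letterSum T a +
        q' ⬝ᵥ (fun i => letterSum T a i - (u a i : ℂ)) + ((∑ i, q i * u a i : ℝ) : ℂ) := by
      push_cast
      simp only [dotProduct, Pi.sub_apply, hq', ← Finset.sum_add_distrib]
      exact Finset.sum_congr rfl fun i _ => by ring
    have h2 : ‖(x - q') ⬝ᵥ letterSum T a‖ ≤ distortion β * τ :=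
      (hT.norm_dot_letterSum_le h hθ a _).trans
        (mul_le_mul_of_nonneg_left hxq distortion_nonneg)
    have h3 : ‖q' ⬝ᵥ (fun i => letterSum T a i - (u a i : ℂ))‖ ≤ (Fintype.card β) ^ 2 * θ :=
      (norm_dotProduct_le q' _ hqn (hT.norm_letterSum_sub_le h a)).trans (le_of_eq (by ring))
    have h4 : 2 * c ≤ ∑ i, q i * u a i := by
      calc 2 * c = ∑ i, q i * (2 * c) := by rw [← Finset.sum_mul, hq1, one_mul]
        _ ≤ _ := Finset.sum_le_sum fun i _ => mul_le_mul_of_nonneg_left (h.le_left a i) (hq0 i)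
    rw [h1, Complex.add_re, Complex.add_re, Complex.ofReal_re]
    have h5 := (abs_le.1 (Complex.abs_re_le_norm ((x - q') ⬝ᵥ letterSum T a))).1
    have h6 := (abs_le.1 (Complex.abs_re_le_norm
      (q' ⬝ᵥ (fun i => letterSum T a i - (u a i : ℂ))))).1
    linarith

/-- The size of perturbations for which the filter preserves good vectors. -/
structure IsSmall (β : Type*) [Fintype β] (c θ : ℝ) : Prop where
  nonneg : 0 ≤ θ
  le_one : θ ≤ 1
  step_le_one : 2 * distortion β / c * θ ≤ 1
  step_le : distortion β * (2 * distortion β / c * θ) + (Fintype.card β) ^ 2 * θ ≤ c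

/-- The output is within `2 * distortion β / c * θ` of the probability vector `v a`, whatever the
good input was, so goodness does not deteriorate along a word. -/
theorem IsNear.isGood_filterStep (h : IsRankOneFamily u v c) (hT : IsNear T u v θ)
    (hθ : IsSmall β c θ) {x : β → ℂ} (hx : IsGood T c x) (a : α) :
    IsGood T c (filterStep T a x) := by
  have hne := hx.dot_ne_zero h.pos a
  refine hT.isGood_of_norm_sub_le h hθ.le_one (h.right_nonneg a) (h.right_sum a) ?_
    hθ.step_le_one ?_ hθ.step_le
  · simp only [filterStep, Pi.smul_apply, smul_eq_mul, ← Finset.mul_sum, sum_vecMul]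
    exact inv_mul_cancel₀ hne
  · rw [filterStep_eq T v a hne, add_sub_cancel_left, norm_smul, norm_inv]
    have h1 := hT.norm_vecMul_rankOneDefect_le h hθ.nonneg a x
    have h2 : ‖x ⬝ᵥ letterSum T a‖⁻¹ ≤ c⁻¹ := inv_anti₀ h.pos (hx.le_norm a)
    have hd := distortion_nonneg (β := β)
    have hθ0 := hθ.nonneg
    have hc := h.pos
    calc _ ≤ c⁻¹ * (distortion β * θ * 2) := by
          refine mul_le_mul h2 (h1.trans ?_) (norm_nonneg _) (by positivity)
          exact mul_le_mul_of_nonneg_left hx.norm_le (by positivity)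
      _ = 2 * distortion β / c * θ := by field_simp

/-- The contraction constant of the filter is `filterLip β c * θ`. -/
def filterLip (β : Type*) [Fintype β] (c : ℝ) : ℝ :=
  distortion β / c + 2 * distortion β ^ 2 / c ^ 2

theorem filterLip_nonneg (hc : 0 < c) : 0 ≤ filterLip β c := by
  have := distortion_nonneg (β := β)
  unfold filterLip
  positivity

/-- In the difference of two outputs `v a` cancels and every remaining term contains the defect,
hence a factor `θ`. The two summands of `filterLip` come from the change of the vector and the
change of the normalising factor. -/
theorem IsNear.norm_filterStep_sub_le (h : IsRankOneFamily u v c) (hT : IsNear T u v θ)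
    (hθ : IsSmall β c θ) {x y : β → ℂ} (hx : IsGood T c x) (hy : IsGood T c y) (a : α) :
    ‖filterStep T a x - filterStep T a y‖ ≤ filterLip β c * θ * ‖x - y‖ := by
  have hxne := hx.dot_ne_zero h.pos a
  have hyne := hy.dot_ne_zero h.pos a
  have hd := distortion_nonneg (β := β)
  have hθ0 := hθ.nonneg
  have hc := h.pos
  set X := x ⬝ᵥ letterSum T a with hX
  set Y := y ⬝ᵥ letterSum T a with hY
  have h2 : ‖X‖⁻¹ ≤ c⁻¹ := inv_anti₀ h.pos (hx.le_norm a)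
  have h3 : ‖Y‖⁻¹ ≤ c⁻¹ := inv_anti₀ h.pos (hy.le_norm a)
  have hYX : ‖Y - X‖ ≤ distortion β * ‖x - y‖ := by
    rw [hX, hY, ← sub_dotProduct, norm_sub_rev x y]
    exact hT.norm_dot_letterSum_le h hθ.le_one a _
  have heq : filterStep T a x - filterStep T a y =
      X⁻¹ • Matrix.vecMul (x - y) (rankOneDefect T v a) +
        ((Y - X) * (X⁻¹ * Y⁻¹)) • Matrix.vecMul y (rankOneDefect T v a) := by
    rw [filterStep_eq T v a hxne, filterStep_eq T v a hyne, Matrix.sub_vecMul]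
    ext j
    simp only [Pi.add_apply, Pi.sub_apply, Pi.smul_apply, smul_eq_mul, ← hX, ← hY]
    field_simp
    ring
  rw [heq]
  refine (norm_add_le _ _).trans ?_
  rw [norm_smul, norm_smul, norm_mul, norm_mul, norm_inv, norm_inv]
  have h4 := hT.norm_vecMul_rankOneDefect_le h hθ.nonneg a (x - y)
  have h5 : ‖Matrix.vecMul y (rankOneDefect T v a)‖ ≤ distortion β * θ * 2 :=
    (hT.norm_vecMul_rankOneDefect_le h hθ.nonneg a y).trans
      (mul_le_mul_of_nonneg_left hy.norm_le (by positivity))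
  calc _ ≤ c⁻¹ * (distortion β * θ * ‖x - y‖) +
        (distortion β * ‖x - y‖ * (c⁻¹ * c⁻¹)) * (distortion β * θ * 2) := by gcongr
    _ = filterLip β c * θ * ‖x - y‖ := by unfold filterLip; field_simp

theorem IsNear.isGood_wordFilter (h : IsRankOneFamily u v c) (hT : IsNear T u v θ)
    (hθ : IsSmall β c θ) {x : β → ℂ} (hx : IsGood T c x) (n : ℕ) (w : Fin n → α) :
    IsGood T c (wordFilter T n w x) := by
  induction n with
  | zero => exact hx
  | succ n ih => exact hT.isGood_filterStep h hθ (ih _) _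

theorem IsNear.norm_wordFilter_sub_le (h : IsRankOneFamily u v c) (hT : IsNear T u v θ)
    (hθ : IsSmall β c θ) {x y : β → ℂ} (hx : IsGood T c x) (hy : IsGood T c y) (n : ℕ)
    (w : Fin n → α) :
    ‖wordFilter T n w x - wordFilter T n w y‖ ≤ (filterLip β c * θ) ^ n * 4 := by
  induction n with
  | zero =>
    have := norm_sub_le x y
    simp only [wordFilter, pow_zero, one_mul]
    linarith [hx.norm_le, hy.norm_le]
  | succ n ih =>
    refine (hT.norm_filterStep_sub_le h hθ (hT.isGood_wordFilter h hθ hx _ _)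
      (hT.isGood_wordFilter h hθ hy _ _) _).trans ?_
    have h0 : 0 ≤ filterLip β c * θ := mul_nonneg (filterLip_nonneg h.pos) hθ.nonneg
    rw [pow_succ', mul_assoc (filterLip β c * θ)]
    exact mul_le_mul_of_nonneg_left (ih _) h0

/-- Relative entropy is quadratic in the difference of the two distributions. -/
theorem norm_sum_mul_log_sub_log_le [Fintype α] {p q : α → ℂ} (hc : 0 < c) {δ : ℝ}
    (hδ : δ ≤ c / 2) (hp : ∀ a, c ≤ (p a).re) (hpq : ∀ a, ‖q a - p a‖ ≤ δ)
    (hsum : ∑ a, p a = ∑ a, q a) :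
    ‖∑ a, p a * (Complex.log (q a) - Complex.log (p a))‖ ≤ Fintype.card α * (δ ^ 2 / c) := by
  have hne : ∀ a, p a ≠ 0 := fun a h0 => by
    have := hp a
    rw [h0, Complex.zero_re] at this
    linarith
  have hnorm : ∀ a, c ≤ ‖p a‖ := fun a => (hp a).trans (Complex.re_le_norm _)
  have hz : ∀ a, ‖(q a - p a) / p a‖ ≤ 1 / 2 := fun a => by
    rw [norm_div, div_le_iff₀ (hc.trans_le (hnorm a))]
    linarith [hpq a, hnorm a]
  have hlog : ∀ a, Complex.log (q a) - Complex.log (p a) =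
      Complex.log (1 + (q a - p a) / p a) := fun a => by
    have h1 : q a = p a * (1 + (q a - p a) / p a) := by
      have := hne a
      field_simp
      ring
    have h2 : 0 < (1 + (q a - p a) / p a).re := by
      have := (abs_le.1 ((Complex.abs_re_le_norm ((q a - p a) / p a)).trans (hz a))).1
      rw [Complex.add_re, Complex.one_re]
      linarith
    have h3 : (1 + (q a - p a) / p a) ≠ 0 := fun h0 => by
      rw [h0, Complex.zero_re] at h2
      exact lt_irrefl _ h2
    -- Both factors lie in the right half-plane, so their arguments add up to less than π in modulus
    -- and the principal logarithm is additive.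
    have h4 := Complex.abs_arg_lt_pi_div_two_iff.2 (Or.inl (hc.trans_le (hp a)))
    have h5 := Complex.abs_arg_lt_pi_div_two_iff.2 (Or.inl h2)
    rw [abs_lt] at h4 h5
    conv_lhs => rw [h1]
    rw [Complex.log_mul (hne a) h3 ⟨by linarith, by linarith⟩, add_sub_cancel_left]
  -- The linear term of the logarithm sums to `∑ (q a - p a) = 0`, since the masses agree; only the
  -- quadratic remainder is left.
  have hdiff : ∑ a, p a * (Complex.log (q a) - Complex.log (p a)) =
      ∑ a, p a * (Complex.log (1 + (q a - p a) / p a) - (q a - p a) / p a) := by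
    simp only [hlog, mul_sub, Finset.sum_sub_distrib]
    have : ∑ a, p a * ((q a - p a) / p a) = 0 := by
      rw [Finset.sum_congr rfl fun a _ => mul_div_cancel₀ (q a - p a) (hne a),
        Finset.sum_sub_distrib, hsum, sub_self]
    rw [this, sub_zero]
  rw [hdiff]
  refine (norm_sum_le_of_le (f := fun a =>
    p a * (Complex.log (1 + (q a - p a) / p a) - (q a - p a) / p a)) (n := fun _ => δ ^ 2 / c)
    _ fun a _ => ?_).trans (by simp)
  rw [norm_mul]
  have h1 := Complex.norm_log_one_add_sub_self_le (z := (q a - p a) / p a)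
    (lt_of_le_of_lt (hz a) (by norm_num))
  have h2 : (1 - ‖(q a - p a) / p a‖)⁻¹ ≤ 2 := by
    rw [inv_le_comm₀ (by linarith [hz a]) two_pos]
    linarith [hz a]
  have hpos : 0 < ‖p a‖ := hc.trans_le (hnorm a)
  calc _ ≤ ‖p a‖ * (‖(q a - p a) / p a‖ ^ 2 * 2 / 2) :=
        mul_le_mul_of_nonneg_left (h1.trans (by gcongr)) hpos.le
    _ = ‖q a - p a‖ ^ 2 / ‖p a‖ := by rw [norm_div]; field_simp
    _ ≤ δ ^ 2 / c := div_le_div₀ (by positivity)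
        (pow_le_pow_left₀ (norm_nonneg _) (hpq a) 2) hc (hnorm a)

theorem sum_dot_letterSum [Fintype α] (hT : ∀ i, ∑ a, ∑ j, T a i j = 1) (x : β → ℂ) :
    ∑ a, x ⬝ᵥ letterSum T a = ∑ i, x i := by
  rw [← dotProduct_sum]
  simp only [dotProduct, Finset.sum_apply, letterSum, hT, mul_one]

/-! ### Word weights and the increments of the complexified entropy. -/

variable [DecidableEq β]

/-- The product of the matrices of the letters of a word; the letter `w 0` is the last factor. -/
def wordMatrix (T : α → Matrix β β ℂ) : (n : ℕ) → (Fin n → α) → Matrix β β ℂ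
  | 0, _ => 1
  | n + 1, w => wordMatrix T n (Fin.tail w) * T (w 0)

theorem wordMatrix_succ_init (T : α → Matrix β β ℂ) (n : ℕ) (w : Fin (n + 1) → α) :
    wordMatrix T (n + 1) w = T (w (Fin.last n)) * wordMatrix T n (Fin.init w) := by
  induction n with
  | zero => simp [wordMatrix]
  | succ n ih =>
    rw [wordMatrix, ih, wordMatrix, Matrix.mul_assoc, Fin.tail_init_eq_init_tail]
    rfl

/-- The weight of a word for the initial vector `x`. -/
def wordWeight (T : α → Matrix β β ℂ) (n : ℕ) (w : Fin n → α) (x : β → ℂ) : ℂ :=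
  ∑ j, Matrix.vecMul x (wordMatrix T n w) j

/-- The conditional entropy of a letter given the `n` previous ones, as a function of complex
matrices `T` and a complex initial vector `x`. -/
def wordEntropy [Fintype α] (T : α → Matrix β β ℂ) (x : β → ℂ) (n : ℕ) : ℂ :=
  -∑ w : Fin n → α, ∑ a, (Matrix.vecMul x (wordMatrix T n w) ⬝ᵥ letterSum T a) *
    Complex.log ((Matrix.vecMul x (wordMatrix T n w) ⬝ᵥ letterSum T a) / wordWeight T n w x)

theorem IsNear.vecMul_wordMatrix (h : IsRankOneFamily u v c) (hT : IsNear T u v θ)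
    (hθ : IsSmall β c θ) {x : β → ℂ} (hx : IsGood T c x) (n : ℕ) (w : Fin n → α) :
    Matrix.vecMul x (wordMatrix T n w) = wordWeight T n w x • wordFilter T n w x := by
  induction n with
  | zero => simp [wordMatrix, wordWeight, wordFilter, hx.sum_eq]
  | succ n ih =>
    have hne := (hT.isGood_wordFilter h hθ hx n (Fin.tail w)).dot_ne_zero h.pos (w 0)
    have h1 : Matrix.vecMul x (wordMatrix T (n + 1) w) =
        wordWeight T n (Fin.tail w) x •
          Matrix.vecMul (wordFilter T n (Fin.tail w) x) (T (w 0)) := by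
      rw [wordMatrix, ← Matrix.vecMul_vecMul, ih, Matrix.smul_vecMul]
    have h2 : wordWeight T (n + 1) w x = wordWeight T n (Fin.tail w) x *
        (wordFilter T n (Fin.tail w) x ⬝ᵥ letterSum T (w 0)) := by
      rw [wordWeight, h1]
      simp only [Pi.smul_apply, smul_eq_mul, ← Finset.mul_sum, sum_vecMul]
    rw [h1, h2, wordFilter, filterStep, smul_smul, mul_assoc, mul_inv_cancel₀ hne, mul_one]

theorem IsNear.wordWeight_succ (h : IsRankOneFamily u v c) (hT : IsNear T u v θ)
    (hθ : IsSmall β c θ) {x : β → ℂ} (hx : IsGood T c x) (n : ℕ) (w : Fin (n + 1) → α) :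
    wordWeight T (n + 1) w x = wordWeight T n (Fin.tail w) x *
      (wordFilter T n (Fin.tail w) x ⬝ᵥ letterSum T (w 0)) := by
  rw [wordWeight, wordMatrix, ← Matrix.vecMul_vecMul, hT.vecMul_wordMatrix h hθ hx,
    Matrix.smul_vecMul]
  simp only [Pi.smul_apply, smul_eq_mul, ← Finset.mul_sum, sum_vecMul]

theorem IsNear.wordWeight_ne_zero (h : IsRankOneFamily u v c) (hT : IsNear T u v θ)
    (hθ : IsSmall β c θ) {x : β → ℂ} (hx : IsGood T c x) (n : ℕ) (w : Fin n → α) :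
    wordWeight T n w x ≠ 0 := by
  induction n with
  | zero => simp [wordWeight, wordMatrix, hx.sum_eq]
  | succ n ih =>
    rw [hT.wordWeight_succ h hθ hx]
    exact mul_ne_zero (ih _) ((hT.isGood_wordFilter h hθ hx _ _).dot_ne_zero h.pos _)

/-- Complex weights are not probabilities, so their moduli need not sum to one. An exponential bound
suffices, as it only enlarges the constant multiplying `θ`. -/
theorem IsNear.norm_wordWeight_le (h : IsRankOneFamily u v c) (hT : IsNear T u v θ)
    (hθ : IsSmall β c θ) {x : β → ℂ} (hx : IsGood T c x) (n : ℕ) (w : Fin n → α) :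
    ‖wordWeight T n w x‖ ≤ (2 * distortion β) ^ n := by
  induction n with
  | zero => simp [wordWeight, wordMatrix, hx.sum_eq]
  | succ n ih =>
    have hd := distortion_nonneg (β := β)
    rw [hT.wordWeight_succ h hθ hx, norm_mul, pow_succ]
    refine mul_le_mul (ih _) ?_ (norm_nonneg _) (by positivity)
    refine (hT.norm_dot_letterSum_le h hθ.le_one _ _).trans ?_
    rw [mul_comm]
    exact mul_le_mul_of_nonneg_right (hT.isGood_wordFilter h hθ hx _ _).norm_le hd

theorem IsNear.dot_div_wordWeight (h : IsRankOneFamily u v c) (hT : IsNear T u v θ)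
    (hθ : IsSmall β c θ) {x : β → ℂ} (hx : IsGood T c x) (n : ℕ) (w : Fin n → α) (a : α) :
    (Matrix.vecMul x (wordMatrix T n w) ⬝ᵥ letterSum T a) / wordWeight T n w x =
      wordFilter T n w x ⬝ᵥ letterSum T a := by
  rw [hT.vecMul_wordMatrix h hθ hx, smul_dotProduct, smul_eq_mul,
    mul_div_cancel_left₀ _ (hT.wordWeight_ne_zero h hθ hx n w)]

/-- The joint weights of a word and the next letter are consistent under removing the first letter
of the word if the initial vector is stationary. -/
theorem sum_snoc_wordMatrix_dot [Fintype α] {x : β → ℂ}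
    (hx : ∑ a, Matrix.vecMul x (T a) = x) (n : ℕ) (w : Fin n → α) (a : α) :
    ∑ b, Matrix.vecMul x (wordMatrix T (n + 1) (Fin.snoc w b : Fin (n + 1) → α)) ⬝ᵥ
      letterSum T a = Matrix.vecMul x (wordMatrix T n w) ⬝ᵥ letterSum T a := by
  simp only [wordMatrix_succ_init, Fin.snoc_last, Fin.init_snoc, ← Matrix.vecMul_vecMul]
  rw [← sum_dotProduct, ← Matrix.sum_vecMul, hx]

theorem sum_fin_succ_eq_sum_snoc [Fintype α] {M : Type*} [AddCommMonoid M] (n : ℕ)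
    (f : (Fin (n + 1) → α) → M) :
    ∑ w, f w = ∑ w : Fin n → α, ∑ b, f (Fin.snoc w b : Fin (n + 1) → α) := by
  rw [← (Fin.snocEquiv fun _ => α).sum_comp, Fintype.sum_prod_type, Finset.sum_comm]
  rfl

/-- Stationarity allows an older letter to be added on which the logarithm does not depend; the
entropies of orders `n` and `n + 1` then become sums over the same words. -/
theorem wordEntropy_eq_sum_succ [Fintype α] {x : β → ℂ}
    (hx : ∑ a, Matrix.vecMul x (T a) = x) (n : ℕ) :
    wordEntropy T x n = -∑ w : Fin (n + 1) → α, ∑ a,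
      (Matrix.vecMul x (wordMatrix T (n + 1) w) ⬝ᵥ letterSum T a) *
      Complex.log ((Matrix.vecMul x (wordMatrix T n (Fin.init w)) ⬝ᵥ letterSum T a) /
        wordWeight T n (Fin.init w) x) := by
  rw [wordEntropy, sum_fin_succ_eq_sum_snoc]
  congr 1
  refine Finset.sum_congr rfl fun w _ => ?_
  rw [Finset.sum_comm]
  refine Finset.sum_congr rfl fun a _ => ?_
  simp only [Fin.init_snoc]
  rw [← Finset.sum_mul, sum_snoc_wordMatrix_dot hx]

/-- The increments of the conditional entropies are of order `θ ^ (2 * n)`. -/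
theorem IsNear.norm_wordEntropy_succ_sub_le [Fintype α] (h : IsRankOneFamily u v c)
    (hT : IsNear T u v θ) (hθ : IsSmall β c θ)
    (hθ' : filterLip β c * θ * (4 * distortion β) ≤ c / 2) (hθ'' : filterLip β c * θ ≤ 1)
    (hT1 : ∀ i, ∑ a, ∑ j, T a i j = 1) {x : β → ℂ} (hx : IsGood T c x)
    (hxT : ∑ a, Matrix.vecMul x (T a) = x) {n : ℕ} (hn : n ≠ 0) :
    ‖wordEntropy T x (n + 1) - wordEntropy T x n‖ ≤
      (Fintype.card α * (2 * distortion β)) *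
        (Fintype.card α * ((4 * distortion β) ^ 2 / c)) *
      ((Fintype.card α * (2 * distortion β) + 1) * filterLip β c * θ) ^ (2 * n) := by
  have hd := distortion_nonneg (β := β)
  have hc := h.pos
  have hl0 : 0 ≤ filterLip β c * θ := mul_nonneg (filterLip_nonneg hc) hθ.nonneg
  have hl1 : (filterLip β c * θ) ^ n ≤ filterLip β c * θ := by
    simpa using pow_le_pow_of_le_one hl0 hθ'' (Nat.one_le_iff_ne_zero.2 hn)
  set δ := (filterLip β c * θ) ^ n * (4 * distortion β) with hδ
  have hδc : δ ≤ c / 2 := (mul_le_mul_of_nonneg_right hl1 (by positivity)).trans hθ'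
  -- For each word, a weight times minus the relative entropy between the predictive laws given all
  -- its letters and given all but the oldest.
  have hterm : wordEntropy T x (n + 1) - wordEntropy T x n =
      ∑ w : Fin (n + 1) → α, wordWeight T (n + 1) w x * ∑ a,
        (wordFilter T (n + 1) w x ⬝ᵥ letterSum T a) *
          (Complex.log (wordFilter T n (Fin.init w) x ⬝ᵥ letterSum T a) -
            Complex.log (wordFilter T (n + 1) w x ⬝ᵥ letterSum T a)) := by
    rw [wordEntropy_eq_sum_succ hxT n, wordEntropy, neg_sub_neg, ← Finset.sum_sub_distrib]
    refine Finset.sum_congr rfl fun w _ => ?_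
    rw [← Finset.sum_sub_distrib, Finset.mul_sum]
    refine Finset.sum_congr rfl fun a _ => ?_
    rw [hT.dot_div_wordWeight h hθ hx, hT.dot_div_wordWeight h hθ hx,
      hT.vecMul_wordMatrix h hθ hx, smul_dotProduct, smul_eq_mul]
    ring
  have hinner : ∀ w : Fin (n + 1) → α, ‖∑ a,
        (wordFilter T (n + 1) w x ⬝ᵥ letterSum T a) *
          (Complex.log (wordFilter T n (Fin.init w) x ⬝ᵥ letterSum T a) -
            Complex.log (wordFilter T (n + 1) w x ⬝ᵥ letterSum T a))‖ ≤
      Fintype.card α * (δ ^ 2 / c) := by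
    intro w
    refine norm_sum_mul_log_sub_log_le hc hδc
      (hT.isGood_wordFilter h hθ hx _ _).le_re (fun a => ?_) ?_
    · rw [wordFilter_succ_init, ← sub_dotProduct]
      refine (hT.norm_dot_letterSum_le h hθ.le_one _ _).trans ?_
      have := hT.norm_wordFilter_sub_le h hθ hx
        (hT.isGood_filterStep h hθ hx (w (Fin.last n))) n (Fin.init w)
      calc _ ≤ distortion β * ((filterLip β c * θ) ^ n * 4) :=
            mul_le_mul_of_nonneg_left this hd
        _ = δ := by rw [hδ]; ring
    · rw [sum_dot_letterSum hT1, sum_dot_letterSum hT1,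
        (hT.isGood_wordFilter h hθ hx _ _).sum_eq, (hT.isGood_wordFilter h hθ hx _ _).sum_eq]
  set X : ℝ := Fintype.card α * (2 * distortion β) with hX
  have hX0 : 0 ≤ X := by positivity
  rw [hterm]
  calc _ ≤ ∑ _w : Fin (n + 1) → α,
        (2 * distortion β) ^ (n + 1) * (Fintype.card α * (δ ^ 2 / c)) := by
        refine norm_sum_le_of_le _ fun w _ => ?_
        rw [norm_mul]
        exact mul_le_mul (hT.norm_wordWeight_le h hθ hx _ _) (hinner w) (norm_nonneg _)
          (by positivity)
    _ = X * (Fintype.card α * ((4 * distortion β) ^ 2 / c)) *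
          (X ^ n * (filterLip β c * θ) ^ (2 * n)) := by
        simp only [Finset.sum_const, Finset.card_univ, Fintype.card_fun, Fintype.card_fin,
          nsmul_eq_mul, hδ, hX]
        push_cast
        ring
    _ ≤ _ := by
        refine mul_le_mul_of_nonneg_left ?_ (by positivity)
        rw [mul_assoc (X + 1), mul_pow (X + 1)]
        refine mul_le_mul_of_nonneg_right ?_ (by positivity)
        -- `X ^ n` collects the number of words and the bound on their weights; passing to `X + 1 ≥
        -- 1` lets it be absorbed into the power `2 * n`.
        calc X ^ n ≤ (X + 1) ^ n := pow_le_pow_left₀ hX0 (by linarith) n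
          _ ≤ (X + 1) ^ (2 * n) := pow_le_pow_right₀ (by linarith) (by omega)

end Words

/-! ### Probabilities of the hidden chain as matrix products. -/

/-- The matrices `Δ_a` over the complex numbers. -/
def letterMatrix {A B : ℕ} (Φ : Fin B → Fin A) (M : Matrix (Fin B) (Fin B) ℂ) (a : Fin A) :
    Matrix (Fin B) (Fin B) ℂ :=
  Matrix.of fun i j => if Φ j = a then M i j else 0

theorem sum_letterMatrix {A B : ℕ} (Φ : Fin B → Fin A) (M : Matrix (Fin B) (Fin B) ℂ)
    (i j : Fin B) : ∑ a, letterMatrix Φ M a i j = M i j := by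
  simp [letterMatrix]

theorem sum_vecMul_letterMatrix {A B : ℕ} (Φ : Fin B → Fin A) (M : Matrix (Fin B) (Fin B) ℂ)
    (x : Fin B → ℂ) : ∑ a, Matrix.vecMul x (letterMatrix Φ M a) = Matrix.vecMul x M := by
  rw [← Matrix.vecMul_sum]
  congr 1
  ext i j
  rw [Matrix.sum_apply, sum_letterMatrix]

namespace IsStationaryMarkovChain

variable {Ω : Type*} [MeasurableSpace Ω] {μ : Measure Ω} {A B : ℕ}
  {Δ : Matrix (Fin B) (Fin B) ℝ} {Y : ℤ → Ω → Fin B}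

/-- The stationary distribution as a complex vector. -/
def law (μ : Measure Ω) (Y : ℤ → Ω → Fin B) : Fin B → ℂ := fun j => (μ.real {ω | Y 0 ω = j} : ℂ)

theorem measureReal_eq (h : IsStationaryMarkovChain μ Δ Y) (k : ℤ) (j : Fin B) :
    μ.real {ω | Y k ω = j} = μ.real {ω | Y 0 ω = j} := by
  have := h.stationary k 1 fun _ => j
  simpa using this

/-- The Markov property, given the values of a function of the past. -/
theorem markov_hidden (h : IsStationaryMarkovChain μ Δ Y) (Φ : Fin B → Fin A) (k : ℤ) (n : ℕ)
    (w : Fin n → Fin A) (l j : Fin B) :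
    μ.real {ω | ((∀ i : Fin n, Φ (Y (k - (i : ℕ)) ω) = w i) ∧ Y k ω = l) ∧ Y (k + 1) ω = j} =
      μ.real {ω | (∀ i : Fin n, Φ (Y (k - (i : ℕ)) ω) = w i) ∧ Y k ω = l} * Δ l j := by
  classical
  have := h.isProbabilityMeasure
  -- The event is split into cylinders of the block from time `k - n` to `k`, to each of which the
  -- Markov property applies. The block runs forward in time and words run backward, whence the
  -- index `n - i` in `s`.
  let V : Ω → Fin (n + 1) → Fin B := fun ω i => Y (k - n + (i : ℕ)) ω
  have hV : ∀ t, MeasurableSet {ω | V ω = t} := fun t =>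
    measurable_pi_lambda V (fun i => h.measurable _) (measurableSet_singleton t)
  let s : Finset (Fin (n + 1) → Fin B) := Finset.univ.filter fun y =>
    (∀ i : Fin n, Φ (y ⟨n - (i : ℕ), by omega⟩) = w i) ∧ y (Fin.last n) = l
  have hs : ∀ ω, V ω ∈ s ↔ (∀ i : Fin n, Φ (Y (k - (i : ℕ)) ω) = w i) ∧ Y k ω = l := by
    intro ω
    simp only [s, V, Finset.mem_filter, Finset.mem_univ, true_and, Fin.val_last,
      sub_add_cancel]
    refine and_congr_left fun _ => forall_congr' fun i => ?_
    have : k - n + ((n - (i : ℕ) : ℕ) : ℤ) = k - (i : ℕ) := by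
      have := i.2
      omega
    rw [this]
  have h1 := measureReal_fiber_sum μ V hV s {ω | Y (k + 1) ω = j}
  have h2 := measureReal_fiber_sum μ V hV s Set.univ
  simp only [hs, Set.mem_univ, and_true, Set.mem_ofPred_eq] at h1 h2
  rw [h1, h2, Finset.sum_mul]
  refine Finset.sum_congr rfl fun y hy => ?_
  have hyl : y (Fin.last n) = l := (Finset.mem_filter.1 hy).2.2
  have h3 := h.markov (k - n) n (Fin.snoc y j : Fin (n + 2) → Fin B)
  simp only [Fin.snoc_castSucc, Fin.snoc_last, hyl] at h3
  have h4 : {ω | V ω = y} = {ω | ∀ i : Fin (n + 1), Y (k - n + (i : ℕ)) ω = y i} := by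
    ext ω
    exact funext_iff
  rw [h4, ← h3]
  congr 1
  ext ω
  simp only [Set.mem_ofPred_eq]
  rw [Fin.forall_fin_succ']
  simp only [Fin.snoc_castSucc, Fin.snoc_last, Fin.val_castSucc, Fin.val_last]
  rw [show k - n + ((n + 1 : ℕ) : ℤ) = k + 1 by push_cast; ring, funext_iff]

/-- Joint probabilities of a hidden word and the last state. -/
theorem measureReal_word (h : IsStationaryMarkovChain μ Δ Y) (Φ : Fin B → Fin A) (n : ℕ) :
    ∀ (k : ℤ) (w : Fin n → Fin A) (j : Fin B),
      (μ.real {ω | (∀ i : Fin n, Φ (Y (k - (i : ℕ)) ω) = w i) ∧ Y k ω = j} : ℂ) =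
        Matrix.vecMul (law μ Y)
          (wordMatrix (letterMatrix Φ (Δ.map Complex.ofReal)) n w) j := by
  classical
  have := h.isProbabilityMeasure
  induction n with
  | zero =>
    intro k w j
    simp [wordMatrix, law, h.measureReal_eq k j]
  | succ n ih =>
    intro k w j
    rw [wordMatrix, ← Matrix.vecMul_vecMul]
    change _ = ∑ l, Matrix.vecMul _ _ l * letterMatrix Φ _ _ l j
    simp_rw [← ih (k - 1)]
    by_cases hj : Φ j = w 0
    · have h1 := measureReal_fiber_sum μ (Y (k - 1))
        (fun t => h.measurable _ (measurableSet_singleton t)) Finset.univ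
        {ω | (∀ i : Fin n, Φ (Y (k - 1 - (i : ℕ)) ω) = Fin.tail w i) ∧ Y k ω = j}
      have h2 : {ω | (∀ i : Fin (n + 1), Φ (Y (k - (i : ℕ)) ω) = w i) ∧ Y k ω = j} =
          {ω | Y (k - 1) ω ∈ Finset.univ ∧
            ω ∈ {ω | (∀ i : Fin n, Φ (Y (k - 1 - (i : ℕ)) ω) = Fin.tail w i) ∧ Y k ω = j}} := by
        ext ω
        simp only [Set.mem_ofPred_eq, Finset.mem_univ, true_and, Fin.forall_fin_succ]
        refine and_congr_left fun hω => ?_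
        simp only [Fin.val_zero, Nat.cast_zero, sub_zero, hω, hj, true_and, Fin.val_succ]
        refine forall_congr' fun i => ?_
        rw [show k - ((i : ℕ) + 1 : ℕ) = k - 1 - (i : ℕ) by push_cast; ring]
        rfl
      rw [h2, h1]
      push_cast
      refine Finset.sum_congr rfl fun l _ => ?_
      have h3 := h.markov_hidden Φ (k - 1) n (Fin.tail w) l j
      rw [sub_add_cancel] at h3
      simp only [letterMatrix, Matrix.of_apply, hj, if_true, Matrix.map_apply]
      rw [← Complex.ofReal_mul, ← h3]
      congr 2
      ext ω
      simp only [Set.mem_ofPred_eq]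
      tauto
    · have h2 : {ω | (∀ i : Fin (n + 1), Φ (Y (k - (i : ℕ)) ω) = w i) ∧ Y k ω = j} = ∅ := by
        ext ω
        simp only [Set.mem_ofPred_eq, Set.mem_empty_iff_false, iff_false, not_and]
        rintro hω rfl
        have := hω 0
        simp only [Fin.val_zero, Nat.cast_zero, sub_zero] at this
        exact hj this
      rw [h2]
      simp [letterMatrix, hj]

theorem law_sum (h : IsStationaryMarkovChain μ Δ Y) : ∑ j, law μ Y j = 1 := by
  have := h.isProbabilityMeasure
  have h1 := measureReal_fiber_sum μ (Y 0)
    (fun t => h.measurable _ (measurableSet_singleton t)) Finset.univ Set.univ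
  simp only [Finset.mem_univ, Set.mem_univ, and_true] at h1
  simp only [law, ← Complex.ofReal_sum, ← h1]
  simp

theorem vecMul_law (h : IsStationaryMarkovChain μ Δ Y) :
    Matrix.vecMul (law μ Y) (Δ.map Complex.ofReal) = law μ Y := by
  have := h.isProbabilityMeasure
  ext j
  have h1 := measureReal_fiber_sum μ (Y 0)
    (fun t => h.measurable _ (measurableSet_singleton t)) Finset.univ {ω | Y 1 ω = j}
  simp only [Finset.mem_univ, true_and, Set.mem_ofPred_eq, h.measureReal_eq 1 j] at h1
  rw [law, h1]
  push_cast
  change ∑ l, law μ Y l * (Δ.map Complex.ofReal) l j = _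
  refine Finset.sum_congr rfl fun l _ => ?_
  -- With the empty word this is the plain one-step transition law.
  have h2 := h.markov_hidden id 0 0 (fun i => i.elim0) l j
  simp only [IsEmpty.forall_iff, true_and, zero_add] at h2
  rw [h2]
  simp [law]

theorem measureReal_block (h : IsStationaryMarkovChain μ Δ Y) (Φ : Fin B → Fin A) (k : ℤ) (n : ℕ)
    (w : Fin n → Fin A) :
    (μ.real {ω | ∀ i : Fin n, Φ (Y (k - (i : ℕ)) ω) = w i} : ℂ) =
      wordWeight (letterMatrix Φ (Δ.map Complex.ofReal)) n w (law μ Y) := by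
  have := h.isProbabilityMeasure
  have h1 := measureReal_fiber_sum μ (Y k)
    (fun t => h.measurable _ (measurableSet_singleton t)) Finset.univ
    {ω | ∀ i : Fin n, Φ (Y (k - (i : ℕ)) ω) = w i}
  simp only [Finset.mem_univ, true_and, Set.mem_ofPred_eq] at h1
  rw [h1, wordWeight]
  push_cast
  refine Finset.sum_congr rfl fun j _ => ?_
  rw [← h.measureReal_word Φ n k w j]
  simp only [and_comm]

theorem blockEntropy_eq (h : IsStationaryMarkovChain μ Δ Y) (Φ : Fin B → Fin A)
    {Z : ℤ → Ω → Fin A} (hZ : ∀ k ω, Z k ω = Φ (Y k ω)) (n : ℕ) :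
    (blockEntropy μ Z n : ℂ) =
      wordEntropy (letterMatrix Φ (Δ.map Complex.ofReal)) (law μ Y) n := by
  have hw : ∀ w : Fin n → Fin A,
      {ω | (fun i : Fin n => Z (-((i : ℕ) + 1)) ω) = w} =
        {ω | ∀ i : Fin n, Φ (Y (-1 - (i : ℕ)) ω) = w i} := by
    intro w
    ext ω
    simp only [Set.mem_ofPred_eq, funext_iff, hZ]
    refine forall_congr' fun i => ?_
    rw [show (-((i : ℕ) + 1 : ℤ)) = -1 - (i : ℕ) by ring]
  have hwa : ∀ (w : Fin n → Fin A) (a : Fin A),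
      {ω | (fun i : Fin n => Z (-((i : ℕ) + 1)) ω) = w ∧ Z 0 ω = a} =
        {ω | ∀ i : Fin (n + 1), Φ (Y (0 - (i : ℕ)) ω) = (Fin.cons a w : Fin (n + 1) → Fin A) i} := by
    intro w a
    ext ω
    simp only [Set.mem_ofPred_eq, funext_iff, hZ, Fin.forall_fin_succ, Fin.cons_zero,
      Fin.cons_succ, Fin.val_zero, Nat.cast_zero, sub_zero, Fin.val_succ]
    rw [and_comm]
    refine and_congr_right fun _ => forall_congr' fun i => ?_
    rw [show (-((i : ℕ) + 1 : ℤ)) = 0 - ((i : ℕ) + 1 : ℕ) by push_cast; ring]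
  rw [blockEntropy, condEntropy, wordEntropy]
  push_cast
  congr 1
  refine Finset.sum_congr rfl fun w _ => Finset.sum_congr rfl fun a _ => ?_
  rw [Complex.ofReal_log (div_nonneg measureReal_nonneg measureReal_nonneg)]
  push_cast
  rw [hwa, hw, h.measureReal_block, h.measureReal_block]
  have h1 : wordWeight (letterMatrix Φ (Δ.map Complex.ofReal)) (n + 1)
      (Fin.cons a w : Fin (n + 1) → Fin A) (law μ Y) =
      Matrix.vecMul (law μ Y) (wordMatrix (letterMatrix Φ (Δ.map Complex.ofReal)) n w) ⬝ᵥ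
        letterSum (letterMatrix Φ (Δ.map Complex.ofReal)) a := by
    rw [wordWeight, wordMatrix, Fin.tail_cons, Fin.cons_zero, ← Matrix.vecMul_vecMul, sum_vecMul]
  rw [h1]

end IsStationaryMarkovChain

/-! ### The limit of the entropies, and smoothness in the parameter. -/

section Smooth

open scoped ContDiff

/-- A sequence of smooth functions on a complex normed space with increments of order `2 * n`
at a point converges, near that point, to a smooth function. -/
theorem exists_limit_of_norm_succ_sub_le {E : Type} [NormedAddCommGroup E] [NormedSpace ℂ E]
    {x : E} {H : ℕ → E → ℂ} {C K : ℝ} (hC : 0 ≤ C) (hK : 0 ≤ K)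
    (hH : ∀ᶠ z in 𝓝 x, ∀ n, ContDiffAt ℂ ∞ (H n) z)
    (hb : ∀ᶠ z in 𝓝 x, ∀ n ≠ 0, ‖H (n + 1) z - H n z‖ ≤ C * (K * ‖z - x‖) ^ (2 * n))
    {n : ℕ} (hn : n ≠ 0) :
    ∃ (G : E → ℂ) (r C' : ℝ), 0 < r ∧ r ≤ 1 ∧ 0 ≤ C' ∧ ContDiffOn ℂ ∞ G (Metric.ball x r) ∧
      ContDiffOn ℂ ∞ (H n) (Metric.ball x r) ∧
      (∀ z ∈ Metric.ball x r, Tendsto (fun k => H k z) atTop (𝓝 (G z))) ∧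
      ∀ z ∈ Metric.ball x r, ‖G z - H n z‖ ≤ C' * ‖z - x‖ ^ (2 * n) := by
  obtain ⟨r₀, hr₀, hball⟩ := Metric.eventually_nhds_iff_ball.1 (hH.and hb)
  -- The last bound gives `K * ‖z - x‖ ≤ 1 / 2`, so the bounds on the increments decay at least like
  -- `(1 / 4) ^ k`; `r ≤ 1` later allows exponents to be lowered.
  let r := min (min r₀ 1) (1 / (2 * (K + 1)))
  have hr : 0 < r := lt_min (lt_min hr₀ one_pos) (by positivity)
  have hrr₀ : r ≤ r₀ := (min_le_left _ _).trans (min_le_left _ _)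
  have hsub : Metric.ball x r ⊆ Metric.ball x r₀ := Metric.ball_subset_ball hrr₀
  have hsm : ∀ k, ContDiffOn ℂ ∞ (H k) (Metric.ball x r) := fun k z hz =>
    ((hball z (hsub hz)).1 k).contDiffWithinAt
  have hKz : ∀ z ∈ Metric.ball x r, K * ‖z - x‖ ≤ 1 / 2 := by
    intro z hz
    have h1 : ‖z - x‖ < r := by simpa [dist_eq_norm] using hz
    have h2 : ‖z - x‖ ≤ 1 / (2 * (K + 1)) := h1.le.trans (min_le_right _ _)
    calc K * ‖z - x‖ ≤ (K + 1) * (1 / (2 * (K + 1))) := by gcongr; linarith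
      _ = 1 / 2 := by field_simp
  have hd : ∀ k, ∀ z ∈ Metric.ball x r, ‖H (n + k + 1) z - H (n + k) z‖ ≤
      C * (K * ‖z - x‖) ^ (2 * n) * (1 / 4) ^ k := by
    intro k z hz
    refine ((hball z (hsub hz)).2 (n + k) (by omega)).trans ?_
    rw [mul_add, pow_add, ← mul_assoc, pow_mul _ 2 k]
    have h0 : 0 ≤ K * ‖z - x‖ := by positivity
    refine mul_le_mul_of_nonneg_left (pow_le_pow_left₀ (by positivity) ?_ k) (by positivity)
    calc (K * ‖z - x‖) ^ 2 ≤ (1 / 2) ^ 2 := pow_le_pow_left₀ h0 (hKz z hz) 2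
      _ = 1 / 4 := by norm_num
  have hgeo : HasSum (fun k : ℕ => (1 / 4 : ℝ) ^ k) (1 - 1 / 4)⁻¹ :=
    hasSum_geometric_of_lt_one (by norm_num) (by norm_num)
  have hd1 : ∀ k, ∀ z ∈ Metric.ball x r,
      ‖H (n + k + 1) z - H (n + k) z‖ ≤ C * (1 / 4) ^ k := by
    intro k z hz
    refine (hd k z hz).trans (mul_le_mul_of_nonneg_right ?_ (by positivity))
    refine mul_le_of_le_one_right hC (pow_le_one₀ (by positivity) ?_)
    linarith [hKz z hz]
  refine ⟨fun z => H n z + ∑' k, (H (n + k + 1) z - H (n + k) z), r,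
    C * K ^ (2 * n) * (1 - 1 / 4)⁻¹, hr, (min_le_left _ _).trans (min_le_right _ _),
    by norm_num; positivity, (hsm n).add
      (contDiffOn_tsum_ball (hgeo.summable.mul_left C)
        (fun k => (hsm _).sub (hsm _)) hd1), hsm n, ?_, ?_⟩
  · intro z hz
    have hs : Summable fun k => H (n + k + 1) z - H (n + k) z :=
      Summable.of_norm_bounded (hgeo.summable.mul_left C) (fun k => hd1 k z hz)
    have h1 := (hs.hasSum.tendsto_sum_nat).const_add (H n z)
    have h2 : ∀ k, H n z + ∑ i ∈ Finset.range k, (H (n + i + 1) z - H (n + i) z) =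
        H (k + n) z := by
      intro k
      have := Finset.sum_range_sub (fun i => H (n + i) z) k
      simp only [← add_assoc, add_zero] at this
      rw [this, add_sub_cancel, add_comm n k]
    simp only [h2] at h1
    exact (tendsto_add_atTop_iff_nat n).1 h1
  · intro z hz
    rw [add_sub_cancel_left]
    refine (tsum_of_norm_bounded (hgeo.mul_left (C * (K * ‖z - x‖) ^ (2 * n)))
      (fun k => hd k z hz)).trans (le_of_eq ?_)
    rw [mul_pow]
    ring

theorem contDiffAt_det {E ι : Type*} [NormedAddCommGroup E] [NormedSpace ℂ E] [Fintype ι]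
    [DecidableEq ι] {M : E → Matrix ι ι ℂ} {z : E}
    (hM : ∀ i j, ContDiffAt ℂ ∞ (fun y => M y i j) z) :
    ContDiffAt ℂ ∞ (fun y => (M y).det) z := by
  simp only [Matrix.det_apply']
  exact ContDiffAt.sum fun σ _ => contDiffAt_const.mul (contDiffAt_prod fun i _ => hM _ _)

theorem contDiffAt_inv {E ι : Type*} [NormedAddCommGroup E] [NormedSpace ℂ E] [Fintype ι]
    [DecidableEq ι] {M : E → Matrix ι ι ℂ} {z : E}
    (hM : ∀ i j, ContDiffAt ℂ ∞ (fun y => M y i j) z) (hdet : (M z).det ≠ 0) (i j : ι) :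
    ContDiffAt ℂ ∞ (fun y => (M y)⁻¹ i j) z := by
  simp only [Matrix.inv_def, Matrix.smul_apply, Ring.inverse_eq_inv', smul_eq_mul,
    Matrix.adjugate_apply]
  refine ((contDiffAt_det hM).inv hdet).mul (contDiffAt_det fun k l => ?_)
  simp only [Matrix.updateRow_apply]
  split_ifs
  · exact contDiffAt_const
  · exact hM k l

theorem contDiffAt_vecMul {E ι : Type*} [NormedAddCommGroup E] [NormedSpace ℂ E] [Fintype ι]
    {M : E → Matrix ι ι ℂ} {x : E → ι → ℂ} {z : E}
    (hM : ∀ i j, ContDiffAt ℂ ∞ (fun y => M y i j) z) (hx : ∀ i, ContDiffAt ℂ ∞ (fun y => x y i) z)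
    (j : ι) : ContDiffAt ℂ ∞ (fun y => Matrix.vecMul (x y) (M y) j) z := by
  simp only [Matrix.vecMul, dotProduct]
  exact ContDiffAt.sum fun i _ => (hx i).mul (hM i j)

variable {E α β : Type*} [NormedAddCommGroup E] [NormedSpace ℂ E] [Fintype β] [DecidableEq β]
  {T : E → α → Matrix β β ℂ} {x : E → β → ℂ} {z : E}

theorem contDiffAt_wordMatrix (hT : ∀ a i j, ContDiffAt ℂ ∞ (fun y => T y a i j) z) (n : ℕ) :
    ∀ (w : Fin n → α) (i j : β), ContDiffAt ℂ ∞ (fun y => wordMatrix (T y) n w i j) z := by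
  induction n with
  | zero =>
    intro w i j
    exact contDiffAt_const
  | succ n ih =>
    intro w i j
    simp only [wordMatrix, Matrix.mul_apply]
    exact ContDiffAt.sum fun k _ => (ih _ _ _).mul (hT _ _ _)

/-- The arguments of the logarithms are the conditional weights, whose real parts are at least `c`,
so they stay off the branch cut for every `n`. -/
theorem contDiffAt_wordEntropy [Fintype α] {u v : α → β → ℝ} {c θ : ℝ}
    (h : IsRankOneFamily u v c) (hT : IsNear (T z) u v θ) (hθ : IsSmall β c θ)
    (hx : IsGood (T z) c (x z)) (hTs : ∀ a i j, ContDiffAt ℂ ∞ (fun y => T y a i j) z)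
    (hxs : ∀ i, ContDiffAt ℂ ∞ (fun y => x y i) z) (n : ℕ) :
    ContDiffAt ℂ ∞ (fun y => wordEntropy (T y) (x y) n) z := by
  have h1 : ∀ (w : Fin n → α) j,
      ContDiffAt ℂ ∞ (fun y => Matrix.vecMul (x y) (wordMatrix (T y) n w) j) z := fun w j =>
    contDiffAt_vecMul (contDiffAt_wordMatrix hTs n w) hxs j
  have h2 : ∀ (w : Fin n → α), ContDiffAt ℂ ∞ (fun y => wordWeight (T y) n w (x y)) z :=
    fun w => ContDiffAt.sum fun j _ => h1 w j
  have h3 : ∀ (w : Fin n → α) (a : α), ContDiffAt ℂ ∞ (fun y =>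
      Matrix.vecMul (x y) (wordMatrix (T y) n w) ⬝ᵥ letterSum (T y) a) z := fun w a =>
    ContDiffAt.sum fun j _ => (h1 w j).mul (ContDiffAt.sum fun k _ => hTs a j k)
  refine ContDiffAt.neg (ContDiffAt.sum fun w _ => ContDiffAt.sum fun a _ => (h3 w a).mul ?_)
  have h4 := (h3 w a).div (h2 w) (hT.wordWeight_ne_zero h hθ hx n w)
  refine ContDiffAt.comp z (g := Complex.log) (f := fun y =>
    Matrix.vecMul (x y) (wordMatrix (T y) n w) ⬝ᵥ letterSum (T y) a / wordWeight (T y) n w (x y))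
    (Complex.contDiffAt_log ?_) h4
  rw [hT.dot_div_wordWeight h hθ hx]
  exact Or.inl (h.pos.trans_le ((hT.isGood_wordFilter h hθ hx n w).le_re a))

end Smooth

/-! ### Rank-one factorisation and the stationary distribution. -/

section Base

/-- `u a` is the vector of row sums and `v a` a normalised row, the same for all rows by rank one.
Rank one also provides a nonzero, hence strictly positive, column, so the row sums are positive; `c`
is half their minimum when there are any. -/
theorem exists_rankOne_of_isBlackHole {A B : ℕ} {Φ : Fin B → Fin A}
    {Δ : Matrix (Fin B) (Fin B) ℝ} (hΔ : Δ ∈ Matrix.rowStochastic ℝ (Fin B))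
    (hBH : IsBlackHole Φ Δ) :
    ∃ (u v : Fin A → Fin B → ℝ) (c : ℝ), IsRankOneFamily u v c ∧
      ∀ a i j, symbolMatrix Φ Δ a i j = u a i * v a j := by
  have key : ∀ a, ∃ u v : Fin B → ℝ, (∀ i, 0 < u i) ∧ (∀ i, u i ≤ 1) ∧ (∀ j, 0 ≤ v j) ∧
      ∑ j, v j = 1 ∧ ∀ i j, symbolMatrix Φ Δ a i j = u i * v j := by
    intro a
    obtain ⟨hrank, hcol⟩ := hBH a
    set S := symbolMatrix Φ Δ a with hS
    have hS0 : ∀ i j, 0 ≤ S i j := fun i j => by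
      rcases hcol j with h | h
      · exact (h i).le
      · exact (h i).ge
    obtain ⟨i₀, j₀, hij⟩ : ∃ i j, S i j ≠ 0 := by
      by_contra! h
      have : S = 0 := by ext i j; exact h i j
      rw [this, Matrix.rank_zero] at hrank
      exact one_ne_zero hrank.symm
    have hj₀ : ∀ i, 0 < S i j₀ := (hcol j₀).resolve_right fun h => hij (h i₀)
    have hupos : ∀ i, 0 < ∑ j, S i j := fun i =>
      (hj₀ i).trans_le (Finset.single_le_sum (fun j _ => hS0 i j) (Finset.mem_univ j₀))
    obtain ⟨y, -, hy⟩ := finrank_eq_one_iff'.1 hrank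
    have hfac : ∃ t : Fin B → ℝ, ∀ i j, S i j = t j * (y : Fin B → ℝ) i := by
      choose t ht using fun j : Fin B =>
        hy ⟨S.mulVecLin (Pi.single j 1), LinearMap.mem_range_self _ _⟩
      refine ⟨t, fun i j => ?_⟩
      have := congrFun (congrArg Subtype.val (ht j)) i
      simpa using this.symm
    obtain ⟨t, ht⟩ := hfac
    refine ⟨fun i => ∑ j, S i j, fun j => S i₀ j / ∑ l, S i₀ l, hupos, fun i => ?_,
      fun j => div_nonneg (hS0 _ _) (hupos _).le, ?_, fun i j => ?_⟩
    · rw [← Matrix.sum_row_of_mem_rowStochastic hΔ i]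
      refine Finset.sum_le_sum fun j _ => ?_
      simp only [hS, symbolMatrix, Matrix.of_apply]
      split_ifs
      · exact le_rfl
      · exact Matrix.nonneg_of_mem_rowStochastic hΔ
    · rw [← Finset.sum_div, div_self (hupos _).ne']
    · rw [mul_div_assoc', eq_div_iff (hupos i₀).ne']
      simp only [ht, ← Finset.sum_mul]
      ring
  choose u v hu0 hu1 hv0 hv1 huv using key
  obtain ⟨c, hc, hcu⟩ : ∃ c > 0, ∀ a i, 2 * c ≤ u a i := by
    rcases isEmpty_or_nonempty (Fin A × Fin B) with h | h
    · exact ⟨1, one_pos, fun a i => (h.false (a, i)).elim⟩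
    · obtain ⟨p, hp⟩ := Finite.exists_min fun p : Fin A × Fin B => u p.1 p.2
      exact ⟨u p.1 p.2 / 2, half_pos (hu0 _ _), fun a i => by
        rw [mul_div_cancel₀ _ two_ne_zero]; exact hp (a, i)⟩
  exact ⟨u, v, c, ⟨hc, hcu, hu1, hv0, hv1⟩, huv⟩

/-- `1 - M + 1 ⊗ w`, whose inverse gives the stationary distribution of `M`. -/
def shiftedMatrix {B : ℕ} (M : Matrix (Fin B) (Fin B) ℂ) (w : Fin B → ℂ) :
    Matrix (Fin B) (Fin B) ℂ :=
  1 - M + Matrix.of fun _ j => w j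

theorem vecMul_shiftedMatrix {B : ℕ} (M : Matrix (Fin B) (Fin B) ℂ) (w x : Fin B → ℂ) :
    Matrix.vecMul x (shiftedMatrix M w) = x - Matrix.vecMul x M + (∑ i, x i) • w := by
  rw [shiftedMatrix, Matrix.vecMul_add, Matrix.vecMul_sub, Matrix.vecMul_one]
  congr 1
  ext j
  simp [Matrix.vecMul, dotProduct, Finset.sum_mul]

/-- The stationary distribution of `M`. -/
def stationaryVector {B : ℕ} (M : Matrix (Fin B) (Fin B) ℂ) (w : Fin B → ℂ) : Fin B → ℂ :=
  Matrix.vecMul w (shiftedMatrix M w)⁻¹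

/-- Stationarity and mass one combine into the single linear equation `x (1 - M + 1 ⊗ w) = w`, whose
solution depends holomorphically on `M`. -/
theorem eq_stationaryVector {B : ℕ} {M : Matrix (Fin B) (Fin B) ℂ} {w x : Fin B → ℂ}
    (hdet : (shiftedMatrix M w).det ≠ 0) (hx : Matrix.vecMul x M = x) (hx1 : ∑ i, x i = 1) :
    x = stationaryVector M w := by
  have h1 : Matrix.vecMul x (shiftedMatrix M w) = w := by
    rw [vecMul_shiftedMatrix, hx, hx1, sub_self, zero_add, one_smul]
  have h2 : Matrix.vecMul (Matrix.vecMul x (shiftedMatrix M w)) (shiftedMatrix M w)⁻¹ = x := by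
    rw [Matrix.vecMul_vecMul, Matrix.mul_nonsing_inv _ hdet.isUnit, Matrix.vecMul_one]
  rw [h1] at h2
  exact h2.symm

theorem sum_stationaryVector {B : ℕ} {M : Matrix (Fin B) (Fin B) ℂ} {w : Fin B → ℂ}
    (hdet : (shiftedMatrix M w).det ≠ 0) (hM : ∀ i, ∑ j, M i j = 1) (hw : ∑ j, w j ≠ 0) :
    ∑ j, stationaryVector M w j = 1 := by
  have h1 : Matrix.mulVec (shiftedMatrix M w) 1 = (∑ j, w j) • 1 := by
    rw [shiftedMatrix, Matrix.add_mulVec, Matrix.sub_mulVec, Matrix.one_mulVec]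
    ext i
    simp [Matrix.mulVec, dotProduct, hM]
  have h2 : (1 : Fin B → ℂ) = (∑ j, w j) • Matrix.mulVec (shiftedMatrix M w)⁻¹ 1 := by
    rw [← Matrix.mulVec_smul, ← h1, Matrix.mulVec_mulVec,
      Matrix.nonsing_inv_mul _ hdet.isUnit, Matrix.one_mulVec]
  have h3 : (∑ j, w j) * (stationaryVector M w ⬝ᵥ 1) = ∑ j, w j := by
    rw [stationaryVector, ← Matrix.dotProduct_mulVec, ← smul_eq_mul, ← dotProduct_smul, ← h2,
      dotProduct_one]
  rw [dotProduct_one] at h3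
  exact mul_left_cancel₀ hw (by rw [h3, mul_one])

theorem vecMul_stationaryVector {B : ℕ} {M : Matrix (Fin B) (Fin B) ℂ} {w : Fin B → ℂ}
    (hdet : (shiftedMatrix M w).det ≠ 0) (hM : ∀ i, ∑ j, M i j = 1) (hw : ∑ j, w j ≠ 0) :
    Matrix.vecMul (stationaryVector M w) M = stationaryVector M w := by
  have h1 : Matrix.vecMul (stationaryVector M w) (shiftedMatrix M w) = w := by
    rw [stationaryVector, Matrix.vecMul_vecMul, Matrix.nonsing_inv_mul _ hdet.isUnit,
      Matrix.vecMul_one]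
  rw [vecMul_shiftedMatrix, sum_stationaryVector hdet hM hw, one_smul, add_eq_right] at h1
  exact (sub_eq_zero.1 h1).symm

/-- Doeblin's minorisation: `Δ - 1 ⊗ w` is nonnegative with row sums `1 - ∑ w < 1`, so one minus it
is strictly diagonally dominant. -/
theorem det_shiftedMatrix_ne_zero {B : ℕ} {Δ : Matrix (Fin B) (Fin B) ℝ} {w : Fin B → ℝ}
    (hΔ : ∀ i, ∑ j, Δ i j = 1) (hw : ∀ i j, w j ≤ Δ i j) (hw1 : 0 < ∑ j, w j) :
    (shiftedMatrix (Δ.map Complex.ofReal) fun j => (w j : ℂ)).det ≠ 0 := by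
  refine det_ne_zero_of_sum_row_lt_diag fun k => ?_
  have h1 : ∀ j ∈ Finset.univ.erase k,
      ‖shiftedMatrix (Δ.map Complex.ofReal) (fun j => (w j : ℂ)) k j‖ = Δ k j - w j := by
    intro j hj
    have hkj : k ≠ j := (Finset.ne_of_mem_erase hj).symm
    have : shiftedMatrix (Δ.map Complex.ofReal) (fun j => (w j : ℂ)) k j =
        ((-(Δ k j - w j) : ℝ) : ℂ) := by
      simp [shiftedMatrix, Matrix.one_apply_ne hkj]
      ring
    rw [this, Complex.norm_real, norm_neg, Real.norm_of_nonneg (sub_nonneg.2 (hw k j))]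
  have h2 : 1 - (Δ k k - w k) ≤
      ‖shiftedMatrix (Δ.map Complex.ofReal) (fun j => (w j : ℂ)) k k‖ := by
    have : shiftedMatrix (Δ.map Complex.ofReal) (fun j => (w j : ℂ)) k k =
        ((1 - (Δ k k - w k) : ℝ) : ℂ) := by
      simp [shiftedMatrix]
      ring
    rw [this, Complex.norm_real]
    exact Real.le_norm_self _
  rw [Finset.sum_congr rfl h1]
  refine lt_of_lt_of_le ?_ h2
  have h3 := Finset.add_sum_erase Finset.univ (fun j => Δ k j - w j) (Finset.mem_univ k)
  rw [Finset.sum_sub_distrib, Finset.sum_sub_distrib, hΔ] at h3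
  rw [Finset.sum_sub_distrib]
  linarith

end Base

theorem eventually_isSmall {β E : Type*} [Fintype β] {c : ℝ} (hc : 0 < c) {l : Filter E}
    {f : E → ℝ} (hf0 : ∀ z, 0 ≤ f z) (hf : Tendsto f l (𝓝 0)) :
    ∀ᶠ z in l, IsSmall β c (f z) := by
  have hlin : ∀ K b : ℝ, 0 < b → ∀ᶠ z in l, K * f z ≤ b := fun K b hb => by
    have := hf.const_mul K
    rw [mul_zero] at this
    exact this.eventually_le_const hb
  filter_upwards [hlin 1 1 one_pos, hlin (2 * distortion β / c) 1 one_pos,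
    hlin (distortion β * (2 * distortion β / c) + (Fintype.card β) ^ 2) c hc] with z h1 h2 h3
  exact ⟨hf0 z, by linarith, h2, by linarith⟩

/-! ### Holomorphic extension of the model and return to real derivatives. -/

section Smooth

open scoped ContDiff

/-- Dividing the extended entries by their row sums forces row sums one at all nearby complex points
and changes nothing on `D`. Row sums one are what make the linear term of the relative entropy
cancel. -/
theorem exists_stochastic_extension {B m : ℕ} {D : Set (Fin m → ℝ)} {e : Fin m → ℝ} (he : e ∈ D)
    {Δ : (Fin m → ℝ) → Matrix (Fin B) (Fin B) ℝ}
    (hΔ : ∀ i j, AnalyticWithinAt ℝ (fun y => Δ y i j) D e)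
    (hst : ∀ y ∈ D, Δ y ∈ Matrix.rowStochastic ℝ (Fin B)) :
    ∃ Q : (Fin m → ℂ) → Matrix (Fin B) (Fin B) ℂ,
      (∀ᶠ z in 𝓝 (realToComplex m e), ∀ i j, ContDiffAt ℂ ∞ (fun y => Q y i j) z) ∧
      (∀ᶠ z in 𝓝 (realToComplex m e), ∀ i, ∑ j, Q z i j = 1) ∧
      ∀ᶠ y in 𝓝[D] e, Q (realToComplex m y) = (Δ y).map Complex.ofReal := by
  choose F r hr hF hFe using fun i j => exists_holomorphic_extension (hΔ i j)
  have hFs : ∀ᶠ z in 𝓝 (realToComplex m e), ∀ i j, ContDiffAt ℂ ∞ (F i j) z := by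
    refine eventually_all.2 fun i => eventually_all.2 fun j => ?_
    filter_upwards [Metric.ball_mem_nhds (realToComplex m e) (hr i j)] with z hz
    exact (hF i j).contDiffAt (Metric.isOpen_ball.mem_nhds hz)
  have hFe' : ∀ᶠ y in 𝓝[D] e, ∀ i j, F i j (realToComplex m y) = Δ y i j := by
    refine eventually_all.2 fun i => eventually_all.2 fun j => ?_
    filter_upwards [self_mem_nhdsWithin,
      mem_nhdsWithin_of_mem_nhds (Metric.ball_mem_nhds e (hr i j))] with y hy hyr
    exact hFe i j y (Set.mem_insert_of_mem _ hy) hyr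
  have hrow : ∀ y ∈ D, ∀ i, ∑ j, (Δ y i j : ℂ) = 1 := fun y hy i => by
    rw [← Complex.ofReal_sum, Matrix.sum_row_of_mem_rowStochastic (hst y hy), Complex.ofReal_one]
  have hne : ∀ᶠ z in 𝓝 (realToComplex m e), ∀ i, ∑ j, F i j z ≠ 0 := by
    refine eventually_all.2 fun i => ?_
    have hcont : ContinuousAt (fun z => ∑ j, F i j z) (realToComplex m e) :=
      (ContDiffAt.sum fun j _ => hFs.self_of_nhds i j).continuousAt
    refine hcont.eventually_ne ?_
    simp only [hFe'.self_of_nhdsWithin he i, hrow e he i]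
    exact one_ne_zero
  refine ⟨fun z => Matrix.of fun i j => F i j z / ∑ k, F i k z, ?_, ?_, ?_⟩
  · filter_upwards [hFs, hne] with z h1 h2 i j
    exact (h1 i j).div (ContDiffAt.sum fun k _ => h1 i k) (h2 i)
  · filter_upwards [hne] with z h i
    simp only [Matrix.of_apply, ← Finset.sum_div]
    exact div_self (h i)
  · filter_upwards [hFe', self_mem_nhdsWithin] with y h hy
    ext i j
    simp [h, hrow y hy i]

/-- Near a matrix with the Black Hole property, the conditional entropies extend holomorphically,
and their increments vanish to high order. -/
theorem exists_holomorphic_wordEntropy {A B : ℕ} {E : Type} [NormedAddCommGroup E]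
    [NormedSpace ℂ E] {Φ : Fin B → Fin A} {Q : E → Matrix (Fin B) (Fin B) ℂ} {z₀ : E}
    (hQ : ∀ᶠ z in 𝓝 z₀, ∀ i j, ContDiffAt ℂ ∞ (fun y => Q y i j) z)
    (hQ1 : ∀ᶠ z in 𝓝 z₀, ∀ i, ∑ j, Q z i j = 1)
    {Δ : Matrix (Fin B) (Fin B) ℝ} (hΔ : Δ ∈ Matrix.rowStochastic ℝ (Fin B))
    (hQΔ : Q z₀ = Δ.map Complex.ofReal) (hBH : IsBlackHole Φ Δ)
    {q : Fin B → ℝ} (hq0 : ∀ j, 0 ≤ q j) (hq1 : ∑ j, q j = 1)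
    (hqΔ : Matrix.vecMul (fun j => (q j : ℂ)) (Δ.map Complex.ofReal) = fun j => (q j : ℂ)) :
    ∃ (x : E → Fin B → ℂ) (C K : ℝ), 0 ≤ C ∧ 0 ≤ K ∧
      (∀ᶠ z in 𝓝 z₀, ∀ n, ContDiffAt ℂ ∞ (fun y => wordEntropy (letterMatrix Φ (Q y)) (x y) n) z) ∧
      (∀ᶠ z in 𝓝 z₀, ∀ n ≠ 0, ‖wordEntropy (letterMatrix Φ (Q z)) (x z) (n + 1) -
        wordEntropy (letterMatrix Φ (Q z)) (x z) n‖ ≤ C * (K * ‖z - z₀‖) ^ (2 * n)) ∧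
      ∀ᶠ z in 𝓝 z₀, ∀ y : Fin B → ℂ, Matrix.vecMul y (Q z) = y → ∑ i, y i = 1 → y = x z := by
  obtain ⟨u, v, c, h, huv⟩ := exists_rankOne_of_isBlackHole hΔ hBH
  have hc := h.pos
  have hl := filterLip_nonneg (β := Fin B) hc
  have hd := distortion_nonneg (β := Fin B)
  have hrow : ∀ i, ∑ j, Δ i j = 1 := Matrix.sum_row_of_mem_rowStochastic hΔ
  -- The minorising vector sits on one strictly positive column of `Δ`. The state `j₁` only supplies
  -- a letter `Φ j₁`.
  obtain ⟨w, hw, hwpos⟩ : ∃ w : Fin B → ℝ, (∀ i j, w j ≤ Δ i j) ∧ 0 < ∑ j, w j := by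
    obtain ⟨j₁, -, -⟩ : ∃ j ∈ Finset.univ, q j ≠ 0 :=
      Finset.exists_ne_zero_of_sum_ne_zero (by rw [hq1]; exact one_ne_zero)
    obtain ⟨j, -, hj⟩ : ∃ j ∈ Finset.univ, v (Φ j₁) j ≠ 0 :=
      Finset.exists_ne_zero_of_sum_ne_zero (by rw [h.right_sum]; exact one_ne_zero)
    have hv : 0 < v (Φ j₁) j := lt_of_le_of_ne (h.right_nonneg _ _) hj.symm
    refine ⟨Pi.single j (2 * c * v (Φ j₁) j), fun i k => ?_, ?_⟩
    · rcases eq_or_ne k j with rfl | hk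
      · rw [Pi.single_eq_same]
        calc 2 * c * v (Φ j₁) k ≤ u (Φ j₁) i * v (Φ j₁) k :=
              mul_le_mul_of_nonneg_right (h.le_left _ _) hv.le
          _ = symbolMatrix Φ Δ (Φ j₁) i k := (huv _ _ _).symm
          _ ≤ Δ i k := by
            simp only [symbolMatrix, Matrix.of_apply]
            split_ifs
            · exact le_rfl
            · exact Matrix.nonneg_of_mem_rowStochastic hΔ
      · rw [Pi.single_eq_of_ne hk]
        exact Matrix.nonneg_of_mem_rowStochastic hΔ
    · rw [Finset.sum_pi_single']
      simp only [Finset.mem_univ, if_true]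
      positivity
  set w' : Fin B → ℂ := fun j => (w j : ℂ) with hw'
  have hwsum : ∑ j, w' j ≠ 0 := by
    rw [hw', ← Complex.ofReal_sum]
    exact Complex.ofReal_ne_zero.2 hwpos.ne'
  have hshift : ∀ᶠ z in 𝓝 z₀, ∀ i j, ContDiffAt ℂ ∞ (fun y => shiftedMatrix (Q y) w' i j) z := by
    filter_upwards [hQ] with z hz i j
    exact (contDiffAt_const.sub (hz i j)).add contDiffAt_const
  have hdet : ∀ᶠ z in 𝓝 z₀, (shiftedMatrix (Q z) w').det ≠ 0 := by
    refine (contDiffAt_det hshift.self_of_nhds).continuousAt.eventually_ne ?_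
    rw [hQΔ]
    exact det_shiftedMatrix_ne_zero hrow hw hwpos
  let x : E → Fin B → ℂ := fun z => stationaryVector (Q z) w'
  have hx : ∀ᶠ z in 𝓝 z₀, ∀ j, ContDiffAt ℂ ∞ (fun y => x y j) z := by
    filter_upwards [hshift, hdet] with z h1 h2 j
    exact contDiffAt_vecMul (M := fun y => (shiftedMatrix (Q y) w')⁻¹) (x := fun _ => w')
      (contDiffAt_inv h1 h2) (fun i => contDiffAt_const) j
  have hx₀ : x z₀ = fun j => (q j : ℂ) := by
    refine (eq_stationaryVector hdet.self_of_nhds ?_ ?_).symm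
    · rw [hQΔ, hqΔ]
    · rw [← Complex.ofReal_sum, hq1, Complex.ofReal_one]
  -- Differentiability at `z₀` makes `θ = L * ‖z - z₀‖` admissible, turning powers of `θ` into
  -- orders of vanishing.
  have hlip : ∃ L ≥ 0, ∀ᶠ z in 𝓝 z₀, ∀ i j, ‖Q z i j - (Δ i j : ℂ)‖ ≤ L * ‖z - z₀‖ := by
    have hdiff : DifferentiableAt ℂ (fun z => fun i j => Q z i j) z₀ :=
      differentiableAt_pi.2 fun i => differentiableAt_pi.2 fun j =>
        (hQ.self_of_nhds i j).differentiableAt (by simp)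
    obtain ⟨L, hL, hbd⟩ := hdiff.isBigO_sub.exists_nonneg
    refine ⟨L, hL, ?_⟩
    filter_upwards [hbd.bound] with z hz i j
    have h1 : Q z₀ i j = (Δ i j : ℂ) := by rw [hQΔ]; rfl
    rw [← h1]
    exact ((norm_le_pi_norm (fun j => Q z i j - Q z₀ i j) j).trans
      (norm_le_pi_norm (fun i j => Q z i j - Q z₀ i j) i)).trans hz
  obtain ⟨L, hL, hlip⟩ := hlip
  have hθ0 : ∀ z : E, 0 ≤ L * ‖z - z₀‖ := fun z => by positivity
  have hθ : Tendsto (fun z : E => L * ‖z - z₀‖) (𝓝 z₀) (𝓝 0) := by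
    have : Continuous fun z : E => L * ‖z - z₀‖ := by fun_prop
    simpa using this.tendsto z₀
  have hsmall := eventually_isSmall (β := Fin B) hc hθ0 hθ
  have hlin : ∀ K b : ℝ, 0 < b → ∀ᶠ z in 𝓝 z₀, K * (L * ‖z - z₀‖) ≤ b := fun K b hb => by
    have := hθ.const_mul K
    rw [mul_zero] at this
    exact this.eventually_le_const hb
  have hnear : ∀ᶠ z in 𝓝 z₀, IsNear (letterMatrix Φ (Q z)) u v (L * ‖z - z₀‖) := by
    filter_upwards [hlip] with z hz a i j
    rw [← Complex.ofReal_mul, ← huv]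
    simp only [letterMatrix, symbolMatrix, Matrix.of_apply]
    split_ifs
    · exact hz i j
    · simpa using hθ0 z
  have hτ : Tendsto (fun z => ‖x z - fun j => (q j : ℂ)‖) (𝓝 z₀) (𝓝 0) := by
    have h1 : ContinuousAt x z₀ := continuousAt_pi.2 fun j =>
      (hx.self_of_nhds j).continuousAt
    have h2 := (h1.sub (continuousAt_const (y := fun j => (q j : ℂ)))).norm.tendsto
    simpa [hx₀] using h2
  have hτθ : ∀ᶠ z in 𝓝 z₀, distortion (Fin B) * ‖x z - fun j => (q j : ℂ)‖ +
      (Fintype.card (Fin B)) ^ 2 * (L * ‖z - z₀‖) ≤ c := by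
    have h1 := (hτ.const_mul (distortion (Fin B))).add
      (hθ.const_mul ((Fintype.card (Fin B) : ℝ) ^ 2))
    rw [mul_zero, mul_zero, add_zero] at h1
    exact h1.eventually_le_const hc
  have hgood : ∀ᶠ z in 𝓝 z₀, IsGood (letterMatrix Φ (Q z)) c (x z) := by
    filter_upwards [hnear, hsmall, hτ.eventually_le_const one_pos, hτθ, hdet, hQ1]
      with z h1 h2 h3 h4 h5 h6
    exact h1.isGood_of_norm_sub_le h h2.le_one hq0 hq1 (sum_stationaryVector h5 h6 hwsum) h3
      le_rfl h4
  refine ⟨x, (Fintype.card (Fin A) * (2 * distortion (Fin B))) *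
        (Fintype.card (Fin A) * ((4 * distortion (Fin B)) ^ 2 / c)),
      (Fintype.card (Fin A) * (2 * distortion (Fin B)) + 1) * filterLip (Fin B) c * L,
      by positivity, by positivity, ?_, ?_, ?_⟩
  · filter_upwards [hnear, hsmall, hgood, hQ, hx] with z h1 h2 h3 h4 h5 n
    refine contDiffAt_wordEntropy (T := fun y => letterMatrix Φ (Q y)) h h1 h2 h3 (fun a i j => ?_) h5 n
    simp only [letterMatrix, Matrix.of_apply]
    split_ifs
    · exact h4 i j
    · exact contDiffAt_const
  · filter_upwards [hnear, hsmall, hgood, hdet, hQ1, hlin (filterLip (Fin B) c) 1 one_pos,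
      hlin (filterLip (Fin B) c * (4 * distortion (Fin B))) (c / 2) (by positivity)]
      with z h1 h2 h3 h4 h5 h6 h7 n hn
    refine (h1.norm_wordEntropy_succ_sub_le h h2 (by linarith) h6 (fun i => ?_) h3 ?_ hn).trans
      (le_of_eq ?_)
    · rw [Finset.sum_comm]
      simp only [sum_letterMatrix, h5]
    · rw [sum_vecMul_letterMatrix]
      exact vecMul_stationaryVector h4 h5 hwsum
    · rw [mul_assoc _ L]
  · filter_upwards [hdet] with z h1 y h2 h3
    exact eq_stationaryVector h1 h2 h3

/-- Two functions on `D` with holomorphic extensions that agree to order `N + 1` have the same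
derivatives of order `N`. -/
theorem contDiffWithinAt_and_mixedPartialWithin_eq {m N : ℕ} {D : Set (Fin m → ℝ)}
    (hD : UniqueDiffOn ℝ D) {e : Fin m → ℝ} (he : e ∈ D) {f g : (Fin m → ℝ) → ℝ}
    {F G : (Fin m → ℂ) → ℂ} {r C : ℝ} (hr : 0 < r)
    (hF : ContDiffOn ℂ ∞ F (Metric.ball (realToComplex m e) r))
    (hG : ContDiffOn ℂ ∞ G (Metric.ball (realToComplex m e) r))
    (hFG : ∀ z ∈ Metric.ball (realToComplex m e) r,
      ‖F z - G z‖ ≤ C * ‖z - realToComplex m e‖ ^ (N + 1))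
    (hf : ∀ᶠ y in 𝓝[D] e, F (realToComplex m y) = f y)
    (hg : ∀ᶠ y in 𝓝[D] e, G (realToComplex m y) = g y) :
    ContDiffWithinAt ℝ N f D e ∧ ContDiffWithinAt ℝ N g D e ∧
      ∀ i : Fin N → Fin m, mixedPartialWithin i f D e = mixedPartialWithin i g D e := by
  have smooth : ∀ {F : (Fin m → ℂ) → ℂ}, ContDiffOn ℂ ∞ F (Metric.ball (realToComplex m e) r) →
      ContDiffAt ℝ N (fun y => Complex.reCLM (F (realToComplex m y))) e := by
    intro F hF
    have h1 : ContDiffAt ℝ N F (realToComplex m e) :=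
      ((hF.contDiffAt (Metric.ball_mem_nhds _ hr)).restrict_scalars ℝ).of_le
        (by exact_mod_cast le_top)
    exact Complex.reCLM.contDiff.contDiffAt.comp e
      (h1.comp e (realToComplex m).contDiff.contDiffAt)
  have ext : ∀ {F : (Fin m → ℂ) → ℂ} {f : (Fin m → ℝ) → ℝ},
      (∀ᶠ y in 𝓝[D] e, F (realToComplex m y) = f y) →
      f =ᶠ[𝓝[D] e] fun y => Complex.reCLM (F (realToComplex m y)) := by
    intro F f hf
    filter_upwards [hf] with y hy
    simp [hy]
  -- Near `e`, `f` is the restriction to `D` of a function smooth on a full neighbourhood, so unique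
  -- differentiability identifies its relative derivatives with ordinary ones.
  have deriv_eq : ∀ {F : (Fin m → ℂ) → ℂ} {f : (Fin m → ℝ) → ℝ},
      ContDiffOn ℂ ∞ F (Metric.ball (realToComplex m e) r) →
      (∀ᶠ y in 𝓝[D] e, F (realToComplex m y) = f y) →
      iteratedFDerivWithin ℝ N f D e =
        iteratedFDeriv ℝ N (fun y => Complex.reCLM (F (realToComplex m y))) e := by
    intro F f hF hf
    rw [(ext hf).iteratedFDerivWithin_eq ((ext hf).self_of_nhdsWithin he),
      iteratedFDerivWithin_eq_iteratedFDeriv hD (smooth hF) he]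
  refine ⟨(smooth hF).contDiffWithinAt.congr_of_eventuallyEq (ext hf)
      ((ext hf).self_of_nhdsWithin he),
    (smooth hG).contDiffWithinAt.congr_of_eventuallyEq (ext hg)
      ((ext hg).self_of_nhdsWithin he), fun i => ?_⟩
  have h0 := iteratedFDeriv_comp_eq_zero (realToComplex m) e N Complex.reCLM hr (hF.sub hG) hFG
  have h1 : (fun y => Complex.reCLM ((F - G) (realToComplex m y))) =
      (fun y => Complex.reCLM (F (realToComplex m y))) -
        fun y => Complex.reCLM (G (realToComplex m y)) := by
    ext y
    simp
  have h2 : iteratedFDeriv ℝ N (fun y => Complex.reCLM (F (realToComplex m y))) e -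
      iteratedFDeriv ℝ N (fun y => Complex.reCLM (G (realToComplex m y))) e = 0 := by
    rw [← iteratedFDeriv_sub_apply (smooth hF) (smooth hG), ← h1]
    exact h0
  rw [mixedPartialWithin, mixedPartialWithin, deriv_eq hF hf, deriv_eq hG hg, sub_eq_zero.1 h2]

end Smooth

end HiddenMarkov

end

/-! ### The main theorem. -/

theorem mainTheorem1 {A B m : ℕ} (Φ : Fin B → Fin A)
    (D : Set (Fin m → ℝ)) (hD : UniqueDiffOn ℝ D)
    (ε₀ : Fin m → ℝ) (hε₀ : ε₀ ∈ D)
    (Δ : (Fin m → ℝ) → Matrix (Fin B) (Fin B) ℝ)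
    (hΔ : ∀ i j, AnalyticWithinAt ℝ (fun ε => Δ ε i j) D ε₀)
    {Ω : (Fin m → ℝ) → Type*} [∀ ε, MeasurableSpace (Ω ε)]
    (P : ∀ ε, Measure (Ω ε)) (Y : ∀ ε, ℤ → Ω ε → Fin B)
    (hY : ∀ ε ∈ D, HiddenMarkov.IsStationaryMarkovChain (P ε) (Δ ε) (Y ε))
    (Z : ∀ ε, ℤ → Ω ε → Fin A) (hZ : ∀ ε k ω, Z ε k ω = Φ (Y ε k ω))
    (hBH : HiddenMarkov.IsBlackHole Φ (Δ ε₀))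
    (N : ℕ) :
    ContDiffWithinAt ℝ N (fun ε => HiddenMarkov.entropyRate (P ε) (Z ε)) D ε₀ ∧
    ContDiffWithinAt ℝ N
      (fun ε => HiddenMarkov.blockEntropy (P ε) (Z ε) ⌈((N : ℝ) + 1) / 2⌉₊) D ε₀ ∧
    ∀ i : Fin N → Fin m,
      HiddenMarkov.mixedPartialWithin i
          (fun ε => HiddenMarkov.entropyRate (P ε) (Z ε)) D ε₀ =
        HiddenMarkov.mixedPartialWithin i
          (fun ε => HiddenMarkov.blockEntropy (P ε) (Z ε) ⌈((N : ℝ) + 1) / 2⌉₊) D ε₀ := by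
  set n := ⌈((N : ℝ) + 1) / 2⌉₊ with hn
  have hn0 : n ≠ 0 := (Nat.ceil_pos.2 (by positivity)).ne'
  -- The only role of the ceiling, besides `n ≠ 0`: agreement to order `2 * n` covers all
  -- derivatives of order `N`.
  have hnN : N + 1 ≤ 2 * n := by
    have h1 : ((N : ℝ) + 1) / 2 ≤ n := Nat.le_ceil _
    have h2 : ((N + 1 : ℕ) : ℝ) ≤ ((2 * n : ℕ) : ℝ) := by push_cast; linarith
    exact_mod_cast h2
  have hst : ∀ y ∈ D, Δ y ∈ Matrix.rowStochastic ℝ (Fin B) := fun y hy =>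
    (hY y hy).isTransitionMatrix
  obtain ⟨Q, hQ, hQ1, hQΔ⟩ := HiddenMarkov.exists_stochastic_extension hε₀ hΔ hst
  have hY₀ := hY ε₀ hε₀
  obtain ⟨x, C, K, hC, hK, hsm, hinc, huniq⟩ :=
    HiddenMarkov.exists_holomorphic_wordEntropy hQ hQ1 (hst ε₀ hε₀)
      (hQΔ.self_of_nhdsWithin hε₀) hBH
      (q := fun j => (P ε₀).real {ω | Y ε₀ 0 ω = j}) (fun j => measureReal_nonneg)
      (by
        have := hY₀.law_sum
        simp only [HiddenMarkov.IsStationaryMarkovChain.law] at this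
        exact_mod_cast this)
      hY₀.vecMul_law
  obtain ⟨G, r, C', hr, hr1, hC', hG, hHn, hlim, hGH⟩ :=
    HiddenMarkov.exists_limit_of_norm_succ_sub_le hC hK hsm hinc hn0
  have hι : Tendsto (HiddenMarkov.realToComplex m) (𝓝[D] ε₀)
      (𝓝 (HiddenMarkov.realToComplex m ε₀)) :=
    ((HiddenMarkov.realToComplex m).continuous.tendsto ε₀).mono_left nhdsWithin_le_nhds
  -- The law of `Y` is a stationary vector of mass one, hence equals the holomorphic one; no
  -- regularity of the law in the parameter is assumed.
  have hblock : ∀ᶠ y in 𝓝[D] ε₀, ∀ k,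
      HiddenMarkov.wordEntropy (HiddenMarkov.letterMatrix Φ (Q (HiddenMarkov.realToComplex m y)))
        (x (HiddenMarkov.realToComplex m y)) k =
      (HiddenMarkov.blockEntropy (P y) (Z y) k : ℂ) := by
    filter_upwards [hQΔ, self_mem_nhdsWithin, hι.eventually huniq] with y h1 hy h2 k
    have h3 := h2 _ (by rw [h1]; exact (hY y hy).vecMul_law) (hY y hy).law_sum
    rw [(hY y hy).blockEntropy_eq Φ (hZ y), h1, h3]
  refine HiddenMarkov.contDiffWithinAt_and_mixedPartialWithin_eq hD hε₀ hr hG hHn (C := C')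
    (fun z hz => (hGH z hz).trans ?_) ?_ ?_
  · have h1 : ‖z - HiddenMarkov.realToComplex m ε₀‖ ≤ 1 := by
      rw [← dist_eq_norm]
      exact (Metric.mem_ball.1 hz).le.trans hr1
    exact mul_le_mul_of_nonneg_left (pow_le_pow_of_le_one (norm_nonneg _) h1 hnN) hC'
  · filter_upwards [hblock, self_mem_nhdsWithin, hι.eventually (Metric.ball_mem_nhds _ hr)]
      with y h1 hy h2
    have := (hY y hy).isProbabilityMeasure
    have hmeas : ∀ k, Measurable (Z y k) := fun k => by
      rw [show Z y k = fun ω => Φ (Y y k ω) from funext (hZ y k)]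
      exact (measurable_of_finite Φ).comp ((hY y hy).measurable k)
    have h3 := hlim _ h2
    simp only [h1] at h3
    exact tendsto_nhds_unique h3
      ((Complex.continuous_ofReal.tendsto _).comp
        (HiddenMarkov.tendsto_blockEntropy (P y) (Z y) hmeas))
  · filter_upwards [hblock] with y h1
    exact h1 n
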